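/- All circuits are over an arbitrary field $\mathbb F$. A depth four ($\Sigma\Pi\Sigma\Pi$) circuit is a layered arithmetic circuit consisting of an output sum gate fed by product gates, which are fed by sum gates, which are fed by product gates, which are fed by input nodes labelled by variables or constants of $\mathbb F$; fan-ins and fan-outs are unbounded, and its size is its number of gates. It is called syntactically multi-$\delta$-ic if for every product gate $u=u_1\times\cdots\times u_t$ and every variable $x$, the variable $x$ appears in (the subcircuits of) at most $\delta$ of the operands $u_1,\dots,u_t$, and $\sum_{j=1}^{t}\deg_x(f_{u_j})\le\delta$, where $f_{u_j}$ is the polynomial computed at $u_j$. For $d$ generic $n\times n$ matrices $X^{(k)}=(x^{(k)}_{i,j})$, $1\le k\le d$, in disjoint sets of variables, let $$\mathsf{IMM}_{n,d}=\sum_{i_1,\dots,i_{d-1}\in[n]}x^{(1)}_{1,i_1}x^{(2)}_{i_1,i_2}\cdots x^{(d-1)}_{i_{d-2},i_{d-1}}x^{(d)}_{i_{d-1},1}.$$ Theorem. There is an absolute constant $c>0$ such that for every function $f:\mathbb N\to\mathbb R$ with $f(n)/\log^2 n\to\infty$ there is an $n_0$ such that the following holds for all integers $n\ge n_0$, $d\ge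 0$ and $\delta\ge 0$ with $f(n)\le d\le n^{0.01}$ and $\delta\le n^{0.016}$: over every field, every syntactically multi-$\delta$-ic depth four circuit computing $\mathsf{IMM}_{n,d}$ has size at least $n^{c\sqrt d}$. -/

import Mathlib

open Filter

/-- An input node of an arithmetic circuit: a variable or a constant of the field. -/
inductive CircuitLeaf (F X : Type*) where
  | var (x : X) : CircuitLeaf F X
  | const (c : F) : CircuitLeaf F X

namespace CircuitLeaf

variable {F X : Type*}

/-- The polynomial computed at an input node. -/
noncomputable def poly [CommSemiring F] : CircuitLeaf F X → MvPolynomial X F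
  | var x => MvPolynomial.X x
  | const c => MvPolynomial.C c

/-- The variable `x` appears at this input node. -/
def Appears (x : X) : CircuitLeaf F X → Prop
  | var y => y = x
  | const _ => False

end CircuitLeaf

/-- A depth four (sum-product-sum-product) arithmetic circuit over `F` in the variables `X`, as a
layered directed acyclic graph.  From the inputs to the output there are: a layer of product gates
fed by input nodes, a layer of sum gates, a layer of product gates, and the output sum gate.
A gate may feed several gates above it, all fan-ins are unbounded, and the incoming wires of a gate
form a multiset, since the same node may be used repeatedly as an operand. -/
structure DepthFourCircuit (F X : Type*) where
  /-- the number of product gates of the bottom layer -/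
  numBottom : ℕ
  /-- the number of sum gates of the middle layer -/
  numMiddle : ℕ
  /-- the number of product gates of the top layer -/
  numTop : ℕ
  /-- the operands of a bottom product gate -/
  bottom : Fin numBottom → Multiset (CircuitLeaf F X)
  /-- the operands of a middle sum gate -/
  middle : Fin numMiddle → Multiset (Fin numBottom)
  /-- the operands of a top product gate -/
  top : Fin numTop → Multiset (Fin numMiddle)
  /-- the operands of the output sum gate -/
  output : Multiset (Fin numTop)

namespace DepthFourCircuit

variable {F X : Type*}

/-- The size: the number of gates (input nodes are not counted). -/
def size (Φ : DepthFourCircuit F X) : ℕ :=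
  Φ.numBottom + Φ.numMiddle + Φ.numTop + 1

section Eval

variable [CommSemiring F]

/-- The polynomial computed at a bottom product gate. -/
noncomputable def bottomPoly (Φ : DepthFourCircuit F X) (g : Fin Φ.numBottom) :
    MvPolynomial X F :=
  ((Φ.bottom g).map CircuitLeaf.poly).prod

/-- The polynomial computed at a middle sum gate. -/
noncomputable def middlePoly (Φ : DepthFourCircuit F X) (g : Fin Φ.numMiddle) :
    MvPolynomial X F :=
  ((Φ.middle g).map Φ.bottomPoly).sum

/-- The polynomial computed at a top product gate. -/
noncomputable def topPoly (Φ : DepthFourCircuit F X) (g : Fin Φ.numTop) :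
    MvPolynomial X F :=
  ((Φ.top g).map Φ.middlePoly).prod

/-- The polynomial computed by the circuit. -/
noncomputable def eval (Φ : DepthFourCircuit F X) : MvPolynomial X F :=
  (Φ.output.map Φ.topPoly).sum

end Eval

/-- The variable `x` appears in the subcircuit rooted at the middle sum gate `g`. -/
def AppearsMiddle (Φ : DepthFourCircuit F X) (x : X) (g : Fin Φ.numMiddle) : Prop :=
  ∃ b ∈ Φ.middle g, ∃ l ∈ Φ.bottom b, l.Appears x

open scoped Classical in
/-- Syntactically multi-`δ`-ic: at every product gate `u = u₁ × ⋯ × uₜ` (of either product layer)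
and for every variable `x`, at most `δ` of the operands `uⱼ`, counted with multiplicity, contain an
appearance of `x`, and the sum over `j` of the degrees in `x` of the polynomials computed at the
`uⱼ` is at most `δ`. -/
def SyntacticallyMultiIc [CommSemiring F] (δ : ℕ) (Φ : DepthFourCircuit F X) : Prop :=
  ∀ x : X,
    (∀ g : Fin Φ.numBottom,
      (Φ.bottom g).countP (fun l => l.Appears x) ≤ δ ∧
      ((Φ.bottom g).map (fun l => l.poly.degreeOf x)).sum ≤ δ) ∧
    (∀ g : Fin Φ.numTop,
      (Φ.top g).countP (fun u => Φ.AppearsMiddle x u) ≤ δ ∧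
      ((Φ.top g).map (fun u => (Φ.middlePoly u).degreeOf x)).sum ≤ δ)

end DepthFourCircuit

/-- The iterated matrix multiplication polynomial: the first diagonal entry of the product of `d`
generic `n × n` matrices, where `(k, i, j)` is the variable at position `(i, j)` of matrix `k`.
It is the sum over index sequences `p 0, p 1, …, p d` that begin and end at the first index, of the
products of the variables at positions `(p k, p (k + 1))` of the matrices `k`. -/
noncomputable def iteratedMatMul (F : Type*) [CommSemiring F] (n d : ℕ) :
    MvPolynomial (Fin d × Fin n × Fin n) F :=
  ∑ p : Fin (d + 1) → Fin n with (p 0 : ℕ) = 0 ∧ (p (Fin.last d) : ℕ) = 0,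
    ∏ k : Fin d, MvPolynomial.X (k, p k.castSucc, p k.succ)

/-!
The proof compares two bounds for the dimension of a space of shifted and projected coefficients.

*The restriction.*  A layered graph with `k ≈ √d` consecutive blocks is placed inside the iterated
matrix product by substituting `0`, `1` and new variables for its entries.  A block has a left and a
right side.  On each side the paths carry one of `α` labels, and pass `L₁ ≈ √d / log n` times from
one of `w` states to another, picking up in each passage `L₂ ≈ log n / 10` variables `z` that are
private to the passage.  A variable `y` in the middle of the block records the pair of the two
labels (`Layer.matrix`, `mulVec_graphLayers`, `exists_substitution`).  Each variable `z` can be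
placed at any one of `q ≈ n ^ 0.1` positions, the others being set to zero.  For a random choice of
the positions a bottom product gate that contains more than `s` of the variables `z` survives with
probability at most `q ^ (-(s + 1))`, so if the circuit has fewer than `q ^ (s + 1)` bottom gates,
some choice kills all of these (`exists_restriction`).  With `s ≈ √d / 2000`, the other case is
already the desired lower bound.

*The measure.*  The polynomial is regarded as a polynomial in `y` with coefficients in the variables
`z`.  The coefficients of the monomials in `y` of degree at most `k` are multiplied by multilinear
monomials with `l` variables on each side, and projected onto multilinear monomials in `z`; the
measure is the dimension of the span.

*Upper bound.*  By the multi-`δ`-ic condition, at most `δ * |Z|` factors of a top product gate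
contain some `z`, and a monomial of degree at most `k` in `y` takes a nonconstant coefficient in at
most `k` of them.  Hence all coefficients of all top gates are sums of products of monomials in at
most `s * k` variables with `numTop * (δ * |Z| + 1) ^ k` fixed polynomials
(`exists_coeff_prod_mem`, `exists_coeff_eval_mem`).  As a multilinear product has no repeated
variable, only sets of nearly `l` variables per side matter as shifts (`card_nearLevel_le`).

*Lower bound.*  The coefficient of a monomial in `y` that selects labels on all sides is the product
of the sums over the paths with these labels (`shiftedVector`).  The rank is bounded from below by
counting the vectors and the overlaps of their supports (`card_sq_le_finrank_span_mul_sum`); both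
counts factor over the sides.  They are obtained by the second moment method for random sets of
variables: such a set avoids some path with a given label with probability of order `1 / L₁`
(`choose_le_card_avoidingSets`), and contains few paths (`sum_card_containedPaths_sq_le`).  The
reason is that two paths which have separated meet again only with probability `1 / w` per step and
that `L₁ ^ 2 ≤ w` (`sum_pair_path_le`).  The density of the random sets is slightly below `1 / 2`,
and `w` is chosen such that about one of the `w` continuations of a path is avoided by the set.

*Comparison.*  Each block contributes a factor of about `α ^ 2` to the lower bound and
`α * n ^ 0.35` to the upper bound, where `α ≥ n ^ 0.75`
(`card_pow_le_of_parameters`, `le_numTop_of_pow_le`), so there are `n ^ Ω(k)` top gates.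
-/

/-! ### Ranks from overlap counts -/

/-- A triangularity bound: in any total order of the coordinates, vectors with distinct leading
coordinates are linearly independent, so the rank is at least the number of leading coordinates,
and Cauchy–Schwarz bounds that number from below in terms of the overlaps of the supports. -/
theorem card_sq_le_finrank_span_mul_sum {ι X F : Type*} [Fintype X] [Field F] [DecidableEq F]
    (s : Finset ι) (v : ι → X → F) (hv : ∀ i ∈ s, v i ≠ 0) :
    s.card ^ 2 ≤ Module.finrank F (Submodule.span F (v '' s)) *
      ∑ x, (s.filter (fun i => v i x ≠ 0)).card ^ 2 := by
  classical
  let e := Fintype.equivFin X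
  have hlead : ∀ i : s, ∃ x : X, v i x ≠ 0 ∧ ∀ y, v i y ≠ 0 → e y ≤ e x := by
    intro i
    obtain ⟨x₀, hx₀⟩ := Function.ne_iff.1 (hv i i.2)
    obtain ⟨x, hx, hmax⟩ := Finset.exists_max_image (Finset.univ.filter (fun x => v i x ≠ 0)) e
      ⟨x₀, by simpa using hx₀⟩
    exact ⟨x, by simpa using hx, fun y hy => hmax y (by simpa using hy)⟩
  choose lead hne hmax using hlead
  let J : Finset X := Finset.univ.image lead
  have hJ : ∀ x : J, ∃ i : s, lead i = x := fun x => by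
    simpa [J] using x.2
  choose rep hrep using hJ
  have hind : LinearIndependent F (fun x : J => v (rep x)) := by
    rw [Fintype.linearIndependent_iff]
    intro g hg
    by_contra! hcon
    obtain ⟨x₀, hx₀⟩ := hcon
    obtain ⟨x, hx, hxmax⟩ := Finset.exists_max_image
      (Finset.univ.filter (fun x => g x ≠ 0)) (fun x : J => e x) ⟨x₀, by simpa using hx₀⟩
    have hx' : g x ≠ 0 := by simpa using hx
    have h0 := congrFun hg (x : X)
    rw [Finset.sum_apply, Finset.sum_eq_single x] at h0
    · have := hne (rep x)
      rw [hrep] at this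
      simp [hx', this] at h0
    · intro y _ hyx
      by_cases hgy : g y = 0
      · simp [hgy]
      · have h1 : e y ≤ e x := hxmax y (by simpa using hgy)
        have h2 : v (rep y) x = 0 := by
          by_contra h3
          have h4 := hmax (rep y) x h3
          rw [hrep] at h4
          exact hyx (Subtype.ext (e.injective (le_antisymm h1 h4)))
        simp [h2]
    · simp
  have hrank : J.card ≤ Module.finrank F (Submodule.span F (v '' s)) := by
    have h1 : Module.finrank F (Submodule.span F (Set.range (fun x : J => v (rep x)))) =
        J.card := by
      rw [finrank_span_eq_card hind, Fintype.card_coe]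
    rw [← h1]
    apply Submodule.finrank_mono
    apply Submodule.span_mono
    rintro _ ⟨x, rfl⟩
    exact ⟨rep x, (rep x).2, rfl⟩
  have hcard : s.card = ∑ x ∈ J, (Finset.univ.filter (fun i : s => lead i = x)).card := by
    rw [← Finset.card_eq_sum_card_image]
    simp
  have hfib : ∀ x, (Finset.univ.filter (fun i : s => lead i = x)).card ≤
      (s.filter (fun i => v i x ≠ 0)).card := by
    intro x
    apply Finset.card_le_card_of_injOn (fun i : s => (i : ι))
    · intro i hi
      have hi' : lead i = x := by simpa using hi
      have := hne i
      rw [hi'] at this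
      simpa using this
    · exact Subtype.val_injective.injOn
  calc s.card ^ 2 = (∑ x ∈ J, (Finset.univ.filter (fun i : s => lead i = x)).card) ^ 2 := by
        rw [← hcard]
    _ ≤ J.card * ∑ x ∈ J, (Finset.univ.filter (fun i : s => lead i = x)).card ^ 2 :=
        sq_sum_le_card_mul_sum_sq
    _ ≤ J.card * ∑ x ∈ J, (s.filter (fun i => v i x ≠ 0)).card ^ 2 := by
        gcongr with x _
        exact hfib x
    _ ≤ _ := by
        gcongr
        exact Finset.subset_univ _

/-! ### Subsets of prescribed size avoiding or containing a given set -/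

theorem card_filter_disjoint_powersetCard {V : Type*} [Fintype V] [DecidableEq V] (B : Finset V)
    (r : ℕ) :
    ((Finset.univ.powersetCard r).filter (fun m => Disjoint B m)).card =
      (Fintype.card V - B.card).choose r := by
  rw [← Finset.card_compl, ← Finset.card_powersetCard]
  congr 1
  ext m
  simp only [Finset.mem_filter, Finset.mem_powersetCard, Finset.subset_univ, true_and]
  rw [and_comm, disjoint_comm, Finset.subset_compl_iff_disjoint_right]

theorem card_filter_subset_powersetCard {V : Type*} [Fintype V] [DecidableEq V] (B : Finset V)
    {r : ℕ} (hr : r ≤ Fintype.card V) :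
    ((Finset.univ.powersetCard r).filter (fun M => B ⊆ M)).card =
      (Fintype.card V - B.card).choose (Fintype.card V - r) := by
  rw [← card_filter_disjoint_powersetCard B]
  apply Finset.card_bij' (fun M _ => Mᶜ) (fun M _ => Mᶜ)
  · simp
  · simp
  · intro M hM
    simp only [Finset.mem_filter, Finset.mem_powersetCard, Finset.subset_univ, true_and] at hM ⊢
    rw [Finset.card_compl, hM.1]
    exact ⟨rfl, by rw [disjoint_compl_right_iff]; exact hM.2⟩
  · intro M hM
    simp only [Finset.mem_filter, Finset.mem_powersetCard, Finset.subset_univ, true_and] at hM ⊢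
    rw [Finset.card_compl, hM.1, Finset.subset_compl_iff_disjoint_right]
    exact ⟨by omega, hM.2⟩

theorem choose_sub_le (N r u : ℕ) (hN : 0 < N) (hr : r ≤ N) :
    ((N - u).choose r : ℝ) ≤ N.choose r * (1 - r / N) ^ u := by
  have hN' : (0 : ℝ) < N := by exact_mod_cast hN
  have hr' : (r : ℝ) ≤ N := by exact_mod_cast hr
  have h0 : (0 : ℝ) ≤ 1 - r / N := by
    rw [sub_nonneg, div_le_one hN']; exact hr'
  induction u with
  | zero => simp
  | succ u ih =>
    have key : ((N - (u + 1)).choose r : ℝ) ≤ (N - u).choose r * (1 - r / N) := by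
      rcases Nat.lt_or_ge u N with hu | hu
      · obtain ⟨v, hv⟩ : ∃ v, N - u = v + 1 := ⟨N - u - 1, by omega⟩
        have hv2 : N - (u + 1) = v := by omega
        rw [hv, hv2]
        rcases Nat.lt_or_ge v r with hvr | hvr
        · rw [Nat.choose_eq_zero_of_lt hvr]
          push_cast
          positivity
        · have h1 := Nat.choose_mul_succ_eq v r
          have h2 : (v.choose r : ℝ) * (v + 1) = (v + 1).choose r * (v + 1 - r) := by
            have h3 : ((v + 1 - r : ℕ) : ℝ) = v + 1 - r := by
              push_cast [Nat.cast_sub (show r ≤ v + 1 by omega)]; ring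
            rw [← h3]; exact_mod_cast h1
          have hv3 : ((v : ℝ) + 1) ≤ N := by
            have : v + 1 ≤ N := by omega
            exact_mod_cast this
          have hv4 : (0 : ℝ) < v + 1 := by positivity
          have h5 : (v.choose r : ℝ) = (v + 1).choose r * (1 - r / (v + 1)) := by
            field_simp
            linarith
          rw [h5]
          gcongr
      · have h1 : N - (u + 1) = 0 := by omega
        have h2 : N - u = 0 := by omega
        rw [h1, h2]
        rcases Nat.eq_zero_or_pos r with h | h
        · simp [h]
        · rw [Nat.choose_eq_zero_of_lt h]; simp
    calc ((N - (u + 1)).choose r : ℝ) ≤ (N - u).choose r * (1 - r / N) := key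
      _ ≤ (N.choose r * (1 - r / N) ^ u) * (1 - r / N) := by gcongr
      _ = _ := by ring

theorem le_choose_sub (N r u D : ℕ) (hu : u ≤ D) (hD : r + D ≤ N) (hN : 0 < N) :
    (N.choose r : ℝ) * (1 - (r + D) / N) ^ u ≤ (N - u).choose r := by
  have hN' : (0 : ℝ) < N := by exact_mod_cast hN
  have hD' : (r : ℝ) + D ≤ N := by exact_mod_cast hD
  have h0 : (0 : ℝ) ≤ 1 - (r + D) / N := by
    rw [sub_nonneg, div_le_one hN']; exact hD'
  induction u with
  | zero => simp
  | succ u ih =>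
    obtain ⟨v, hv⟩ : ∃ v, N - u = v + 1 := ⟨N - u - 1, by omega⟩
    have hv2 : N - (u + 1) = v := by omega
    have ih' := ih (by omega)
    rw [hv] at ih'
    rw [hv2]
    have h1 := Nat.choose_mul_succ_eq v r
    have h2 : (v.choose r : ℝ) * (v + 1) = (v + 1).choose r * (v + 1 - r) := by
      have h3 : ((v + 1 - r : ℕ) : ℝ) = v + 1 - r := by
        push_cast [Nat.cast_sub (show r ≤ v + 1 by omega)]; ring
      rw [← h3]; exact_mod_cast h1
    have hv3 : (N : ℝ) = v + 1 + u := by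
      have : N = v + 1 + u := by omega
      exact_mod_cast this
    have hv4 : (0 : ℝ) < v + 1 := by positivity
    have h5 : (v.choose r : ℝ) = (v + 1).choose r * (1 - r / (v + 1)) := by
      field_simp
      linarith
    have hu' : ((u : ℝ) + 1) ≤ D := by exact_mod_cast hu
    have h6 : 1 - ((r : ℝ) + D) / N ≤ 1 - r / (v + 1) := by
      rw [sub_le_sub_iff_left, div_le_div_iff₀ hv4 hN', hv3]
      rw [hv3] at hD'
      have : (0:ℝ) ≤ r := by positivity
      nlinarith
    calc (N.choose r : ℝ) * (1 - (r + D) / N) ^ (u + 1)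
        = (N.choose r * (1 - (r + D) / N) ^ u) * (1 - (r + D) / N) := by ring
      _ ≤ (v + 1).choose r * (1 - r / (v + 1)) := by gcongr
      _ = _ := h5.symm

/-- Consecutive binomial coefficients above `r` grow by a factor of at most `(N - r) / r`. -/
theorem choose_add_le (N r e : ℕ) (hr : 0 < r) (hN : r ≤ N) :
    (N.choose (r + e) : ℝ) ≤ N.choose r * (((N : ℝ) - r) / r) ^ e := by
  have hr' : (0 : ℝ) < r := by exact_mod_cast hr
  have hN' : (r : ℝ) ≤ N := by exact_mod_cast hN
  have h0 : (0 : ℝ) ≤ ((N : ℝ) - r) / r := div_nonneg (by linarith) hr'.le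
  induction e with
  | zero => simp
  | succ e ih =>
    have key : (N.choose (r + e + 1) : ℝ) ≤ N.choose (r + e) * (((N : ℝ) - r) / r) := by
      rcases Nat.lt_or_ge N (r + e) with h | h
      · rw [Nat.choose_eq_zero_of_lt (show N < r + e + 1 by omega)]
        push_cast
        positivity
      · have h1 := Nat.choose_succ_right_eq N (r + e)
        have h2 : (N.choose (r + e + 1) : ℝ) * (r + e + 1) = N.choose (r + e) * (N - (r + e)) := by
          have h3 : ((N - (r + e) : ℕ) : ℝ) = N - (r + e) := by
            push_cast [Nat.cast_sub h]; ring
          rw [← h3]; exact_mod_cast h1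
        have h4 : (N.choose (r + e + 1) : ℝ) =
            N.choose (r + e) * ((N - (r + e)) / (r + e + 1)) := by
          field_simp
          linarith
        rw [h4]
        have h5 : (r : ℝ) + e ≤ N := by exact_mod_cast h
        gcongr
        · linarith
        · linarith [show (0:ℝ) ≤ e by positivity]
    calc (N.choose (r + (e + 1)) : ℝ) ≤ N.choose (r + e) * (((N : ℝ) - r) / r) := key
      _ ≤ (N.choose r * (((N : ℝ) - r) / r) ^ e) * (((N : ℝ) - r) / r) := by gcongr
      _ = _ := by ring

/-! ### Layered paths -/

/-- The state from which the `i`-th step of the path `u` with starting state `x` departs. -/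
def prevState {Q : Type*} {L : ℕ} (x : Q) (u : Fin L → Q) (i : Fin L) : Q :=
  (Fin.cons x u : Fin (L + 1) → Q) i.castSucc

@[simp] theorem prevState_cons_zero {Q : Type*} {L : ℕ} (x y : Q) (u : Fin L → Q) :
    prevState x (Fin.cons y u : Fin (L + 1) → Q) 0 = x := rfl

@[simp] theorem prevState_cons_succ {Q : Type*} {L : ℕ} (x y : Q) (u : Fin L → Q) (i : Fin L) :
    prevState x (Fin.cons y u : Fin (L + 1) → Q) i.succ = prevState y u i := by
  unfold prevState
  rw [← Fin.succ_castSucc, Fin.cons_succ]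

theorem sum_fin_cons {Q M : Type*} [Fintype Q] [AddCommMonoid M] {L : ℕ}
    (f : (Fin (L + 1) → Q) → M) :
    ∑ u, f u = ∑ y, ∑ u : Fin L → Q, f (Fin.cons y u : Fin (L + 1) → Q) := by
  rw [← (Fin.consEquiv (fun _ => Q)).sum_comp, Fintype.sum_prod_type]
  rfl

theorem sum_path_succ {Q R : Type*} [Fintype Q] [CommSemiring R] {L : ℕ}
    (g : Fin (L + 1) → Q → Q → R) (x : Q) :
    ∑ u : Fin (L + 1) → Q, ∏ i, g i (prevState x u i) (u i) =
      ∑ y, g 0 x y * ∑ u : Fin L → Q, ∏ i, g i.succ (prevState y u i) (u i) := by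
  rw [sum_fin_cons]
  simp only [Fin.prod_univ_succ, prevState_cons_zero, prevState_cons_succ,
    Fin.cons_zero, Fin.cons_succ, Finset.mul_sum]

/-- Two paths weighted by `W` for each common step.  Once they have separated, they meet again with
probability `1 / |Q|` in each step, so for `L² ≤ |Q|` a weight `W ≈ |Q|` is absorbed by the
probability of staying together, up to a factor linear in `L`. -/
theorem sum_pair_path_le {Q : Type*} [Fintype Q] [DecidableEq Q] {W κ : ℝ} (hκ : 1 ≤ κ)
    (hW0 : 0 ≤ W) (hW : W ≤ κ * Fintype.card Q) (L : ℕ) (hL : L ^ 2 ≤ Fintype.card Q) (x x' : Q) :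
    ∑ u : Fin L → Q, ∑ u' : Fin L → Q,
        ∏ i, (if prevState x u i = prevState x' u' i ∧ u i = u' i then W else 1) ≤
      (Fintype.card Q : ℝ) ^ (2 * L) * κ ^ L *
        (if x = x' then (2 * L + 1 : ℝ) else 1 + (L : ℝ) ^ 2 / Fintype.card Q) := by
  have hw : (0 : ℝ) < Fintype.card Q := by
    exact_mod_cast Fintype.card_pos_iff.2 ⟨x⟩
  set w : ℝ := (Fintype.card Q : ℝ) with hwdef
  induction L generalizing x x' with
  | zero => simp
  | succ L ih =>
    have hL' : L ^ 2 ≤ Fintype.card Q := le_trans (Nat.pow_le_pow_left (Nat.le_succ L) 2) hL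
    have ih' := ih hL'
    have hLw : (L : ℝ) ^ 2 / w ≤ 1 := by
      rw [div_le_one hw, hwdef]
      exact_mod_cast hL'
    have hstep : ∑ u : Fin (L + 1) → Q, ∑ u' : Fin (L + 1) → Q,
        ∏ i, (if prevState x u i = prevState x' u' i ∧ u i = u' i then W else 1) =
        ∑ y, ∑ y', (if x = x' ∧ y = y' then W else 1) * ∑ u : Fin L → Q, ∑ u' : Fin L → Q,
          ∏ i, (if prevState y u i = prevState y' u' i ∧ u i = u' i then W else 1) := by
      rw [sum_fin_cons]
      refine Finset.sum_congr rfl fun y _ => ?_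
      simp_rw [sum_fin_cons (fun u' : Fin (L + 1) → Q => ∏ i, _)]
      rw [Finset.sum_comm]
      refine Finset.sum_congr rfl fun y' _ => ?_
      simp only [Fin.prod_univ_succ, prevState_cons_zero, prevState_cons_succ, Fin.cons_zero,
        Fin.cons_succ, Finset.mul_sum]
    rw [hstep]
    set S : ℝ := w ^ (2 * L) * κ ^ L * (2 * L + 1)
    set T : ℝ := w ^ (2 * L) * κ ^ L * (1 + (L : ℝ) ^ 2 / w)
    have hκ0 : 0 < κ := by linarith
    have hT0 : 0 ≤ T := by positivity
    have hS0 : 0 ≤ S := by positivity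
    have hbound : ∀ y y', ∑ u : Fin L → Q, ∑ u' : Fin L → Q,
          ∏ i, (if prevState y u i = prevState y' u' i ∧ u i = u' i then W else 1) ≤
          (if y = y' then S else 0) + T := by
      intro y y'
      refine (ih' y y').trans ?_
      split_ifs with h
      · exact le_add_of_nonneg_right hT0
      · rw [zero_add]
    by_cases hx : x = x'
    · calc _ ≤ ∑ y : Q, ∑ y' : Q, ((if y = y' then W * S else 0) + T) := by
            refine Finset.sum_le_sum fun y _ => Finset.sum_le_sum fun y' _ => ?_
            by_cases hy : y = y'
            · have h1 := ih' y y
              rw [if_pos rfl] at h1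
              subst hx hy
              simp only [and_self, if_true]
              exact (mul_le_mul_of_nonneg_left h1 hW0).trans (le_add_of_nonneg_right hT0)
            · have := hbound y y'
              simpa [hx, hy] using this
        _ = w * (W * S + w * T) := by
            simp [Finset.sum_add_distrib, hwdef]
            ring
        _ ≤ w * (κ * w * S + w * T) := by gcongr
        _ ≤ _ := by
            have hP : 0 ≤ w ^ (2 * L) * κ ^ L := by positivity
            have h1 : T ≤ w ^ (2 * L) * κ ^ L * 2 := by
              simp only [T]
              gcongr
              linarith
            have h2 : w ^ (2 * L) * κ ^ L * 2 ≤ w ^ (2 * L) * κ ^ L * 2 * κ :=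
              le_mul_of_one_le_right (by positivity) hκ
            rw [if_pos hx]
            calc w * (κ * w * S + w * T) = w ^ 2 * (κ * S + T) := by ring
              _ ≤ w ^ 2 * (κ * S + w ^ (2 * L) * κ ^ L * 2 * κ) := by
                  gcongr
                  exact h1.trans h2
              _ = _ := by
                  simp only [S]
                  push_cast
                  ring
    · calc _ ≤ ∑ y : Q, ∑ y' : Q, ((if y = y' then S else 0) + T) := by
            refine Finset.sum_le_sum fun y _ => Finset.sum_le_sum fun y' _ => ?_
            simpa [hx] using hbound y y'
        _ = w * (S + w * T) := by
            simp [Finset.sum_add_distrib, hwdef]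
            ring
        _ = w ^ (2 * (L + 1)) * κ ^ L * (1 + ((L + 1 : ℕ) : ℝ) ^ 2 / w) := by
            simp only [S, T]
            push_cast
            field_simp
            ring
        _ ≤ _ := by
            rw [if_neg hx]
            gcongr
            exact Nat.le_succ L

/-- The variables of one side: a label, the position of a layer in a path (step, layer inside the
step), and the two end states of that step. -/
abbrev Slot (A Q : Type*) (L₁ L₂ : ℕ) := A × Fin L₁ × Fin L₂ × Q × Q

section Trail

variable {A Q : Type*} [DecidableEq A] [DecidableEq Q] [Inhabited Q]
  {L₁ L₂ : ℕ}

/-- The variables along the path `u` with label `a`: each step passes through `L₂` variables that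
are private to the pair of its end states. -/
def trail (L₂ : ℕ) (a : A) (u : Fin L₁ → Q) : Finset (Slot A Q L₁ L₂) :=
  Finset.univ.image
    (fun p : Fin L₁ × Fin L₂ => (a, p.1, p.2, prevState default u p.1, u p.1))

theorem mem_trail {a : A} {u : Fin L₁ → Q} {z : Slot A Q L₁ L₂} :
    z ∈ trail L₂ a u ↔
      z.1 = a ∧ z.2.2.2.1 = prevState default u z.2.1 ∧ z.2.2.2.2 = u z.2.1 := by
  obtain ⟨b, i, j, x, y⟩ := z
  simp only [trail, Finset.mem_image, Finset.mem_univ, true_and, Prod.mk.injEq, Prod.exists]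
  constructor
  · rintro ⟨i', j', rfl, rfl, rfl, rfl, rfl⟩
    exact ⟨rfl, rfl, rfl⟩
  · rintro ⟨rfl, rfl, rfl⟩
    exact ⟨i, j, rfl, rfl, rfl, rfl, rfl⟩

theorem card_trail (a : A) (u : Fin L₁ → Q) : (trail L₂ a u).card = L₁ * L₂ := by
  unfold trail
  rw [Finset.card_image_of_injective]
  · simp
  · rintro ⟨i, j⟩ ⟨i', j'⟩ h
    simp only [Prod.mk.injEq] at h
    simp [h.2.1, h.2.2.1]

theorem trail_injective (hL₂ : 0 < L₂) (a : A) :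
    Function.Injective (trail (L₁ := L₁) (Q := Q) L₂ a) := by
  intro u u' h
  funext i
  have h1 : (a, i, (⟨0, hL₂⟩ : Fin L₂), prevState default u i, u i) ∈ trail L₂ a u := by
    simp [mem_trail]
  rw [h] at h1
  exact (mem_trail.1 h1).2.2

theorem disjoint_trail {a a' : A} (h : a ≠ a') (u u' : Fin L₁ → Q) :
    Disjoint (trail L₂ a u) (trail L₂ a' u') := by
  rw [Finset.disjoint_left]
  intro z hz hz'
  exact h ((mem_trail.1 hz).1.symm.trans (mem_trail.1 hz').1)

/-- Under a weight `t` for each variable of the union of two trails, each common step is rewarded by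
the factor `t⁻¹ ^ L₂`. -/
theorem pow_card_trail_union {t : ℝ} (ht : 0 < t) (a : A) (u u' : Fin L₁ → Q) :
    t ^ (trail L₂ a u ∪ trail L₂ a u').card = t ^ (2 * (L₁ * L₂)) *
      ∏ i, (if prevState default u i = prevState default u' i ∧ u i = u' i
        then (t⁻¹) ^ L₂ else 1) := by
  set Sh : Finset (Fin L₁) := Finset.univ.filter
    (fun i => prevState default u i = prevState default u' i ∧ u i = u' i) with hSh
  have hinter : (trail L₂ a u ∩ trail L₂ a u').card = Sh.card * L₂ := by
    have : trail L₂ a u ∩ trail L₂ a u' = (Sh ×ˢ (Finset.univ : Finset (Fin L₂))).image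
        (fun p : Fin L₁ × Fin L₂ => (a, p.1, p.2, prevState default u p.1, u p.1)) := by
      ext ⟨b, i, j, x, y⟩
      simp only [Finset.mem_inter, mem_trail, Finset.mem_image, Finset.mem_product, Finset.mem_univ,
        and_true, Prod.mk.injEq, Prod.exists, hSh, Finset.mem_filter, true_and]
      constructor
      · rintro ⟨⟨rfl, rfl, rfl⟩, -, h1, h2⟩
        exact ⟨i, j, ⟨h1, h2⟩, rfl, rfl, rfl, rfl, rfl⟩
      · rintro ⟨i', j', ⟨h1, h2⟩, rfl, rfl, rfl, rfl, rfl⟩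
        exact ⟨⟨rfl, rfl, rfl⟩, rfl, h1, h2⟩
    rw [this, Finset.card_image_of_injective]
    · simp
    · rintro ⟨i, j⟩ ⟨i', j'⟩ h
      simp only [Prod.mk.injEq] at h
      simp [h.2.1, h.2.2.1]
  have hprod : ∏ i, (if prevState default u i = prevState default u' i ∧ u i = u' i
        then (t⁻¹) ^ L₂ else 1) = (t⁻¹) ^ (Sh.card * L₂) := by
    rw [Finset.prod_ite, Finset.prod_const, Finset.prod_const_one, mul_one, ← pow_mul, mul_comm]
  have hsum := Finset.card_union_add_card_inter (trail L₂ a u) (trail L₂ a u')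
  rw [card_trail, card_trail, hinter] at hsum
  rw [hprod, inv_pow, ← div_eq_mul_inv, eq_div_iff (by positivity), ← pow_add, hsum, two_mul]

theorem sum_pow_card_trail_union_le [Fintype Q] {t κ : ℝ} (ht : 0 < t) (hκ : 1 ≤ κ)
    (hW : (t⁻¹) ^ L₂ ≤ κ * Fintype.card Q) (hL : L₁ ^ 2 ≤ Fintype.card Q) (a : A) :
    ∑ u : Fin L₁ → Q, ∑ u' : Fin L₁ → Q, t ^ (trail L₂ a u ∪ trail L₂ a u').card ≤
      t ^ (2 * (L₁ * L₂)) * ((Fintype.card Q : ℝ) ^ (2 * L₁) * κ ^ L₁ * (2 * L₁ + 1)) := by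
  have h := sum_pair_path_le hκ (by positivity) hW L₁ hL (default : Q) default
  rw [if_pos rfl] at h
  simp_rw [pow_card_trail_union ht, ← Finset.mul_sum]
  gcongr

end Trail

/-! ### Sets avoiding a path and sets containing a path -/

section Count

variable {A Q : Type*} [Fintype A] [DecidableEq A] [Fintype Q] [DecidableEq Q] [Inhabited Q]
  {L₁ L₂ : ℕ}

/-- The `l`-sets of variables that are disjoint from some path with label `a`. -/
def avoidingSets (L₁ L₂ l : ℕ) (Q : Type*) [Fintype Q] [DecidableEq Q] [Inhabited Q] (a : A) :
    Finset (Finset (Slot A Q L₁ L₂)) :=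
  (Finset.univ.powersetCard l).filter (fun m => ∃ u : Fin L₁ → Q, Disjoint (trail L₂ a u) m)

/-- The labelled paths that are contained in the set `M` of variables. -/
def containedPaths (M : Finset (Slot A Q L₁ L₂)) : Finset (A × (Fin L₁ → Q)) :=
  Finset.univ.filter (fun p => trail L₂ p.1 p.2 ⊆ M)

theorem sum_card_filter_sq {ι κ : Type*} [Fintype κ] (s : Finset ι) (P : ι → κ → Prop)
    [∀ i, DecidablePred (P i)] :
    ∑ i ∈ s, (Finset.univ.filter (P i)).card ^ 2 =
      ∑ x, ∑ y, (s.filter (fun i => P i x ∧ P i y)).card := by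
  simp_rw [Finset.card_filter, sq, Finset.sum_mul_sum]
  rw [Finset.sum_comm]
  refine Finset.sum_congr rfl fun x _ => ?_
  rw [Finset.sum_comm]
  refine Finset.sum_congr rfl fun y _ => Finset.sum_congr rfl fun i _ => ?_
  by_cases h1 : P i x <;> by_cases h2 : P i y <;> simp [h1, h2]

/-- Second moment method: a fraction of order `1 / L₁` of all sets of density at most `1 / 2` avoid
some path with a given label.  The hypothesis `hw` says that the expected number of avoided
continuations of a step is at least `1`. -/
theorem choose_le_card_avoidingSets {l N : ℕ} (hN : Fintype.card (Slot A Q L₁ L₂) = N)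
    (hN0 : 0 < N) (hr : (1 / 2 : ℝ) ≤ 1 - (l : ℝ) / N)
    (hw : ((1 - (l : ℝ) / N)⁻¹) ^ L₂ ≤ Fintype.card Q) (hL : L₁ ^ 2 ≤ Fintype.card Q)
    (hD : 4 * (L₁ * L₂) ^ 2 ≤ N) (a : A) :
    (N.choose l : ℝ) ≤ 4 * (2 * L₁ + 1) * (avoidingSets L₁ L₂ l Q a).card := by
  set D := L₁ * L₂ with hDdef
  set r : ℝ := 1 - (l : ℝ) / N with hrdef
  have hN' : (0 : ℝ) < N := by exact_mod_cast hN0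
  have hr0 : 0 < r := by linarith
  have hlN : 2 * l ≤ N := by
    have h1 : (l : ℝ) / N ≤ 1 / 2 := by linarith
    rw [div_le_iff₀ hN'] at h1
    have h2 : (2 * l : ℝ) ≤ N := by linarith
    exact_mod_cast h2
  have hw0 : (0 : ℝ) < Fintype.card Q := by exact_mod_cast Fintype.card_pos
  set w : ℝ := (Fintype.card Q : ℝ) with hwdef
  have hCpos : (0 : ℝ) < N.choose l := by exact_mod_cast Nat.choose_pos (by omega)
  set S := avoidingSets L₁ L₂ l Q a with hS
  let P : Finset (Slot A Q L₁ L₂) → (Fin L₁ → Q) → Prop := fun m u => Disjoint (trail L₂ a u) m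
  let Y : Finset (Slot A Q L₁ L₂) → ℕ := fun m => (Finset.univ.filter (P m)).card
  have hfirst : ∑ m ∈ Finset.univ.powersetCard l, Y m =
      Fintype.card Q ^ L₁ * (N - D).choose l := by
    simp only [Y, Finset.card_filter]
    rw [Finset.sum_comm]
    simp_rw [← Finset.card_filter, P, card_filter_disjoint_powersetCard, card_trail, hN]
    simp [hDdef]
  have hsupp : ∑ m ∈ Finset.univ.powersetCard l, Y m = ∑ m ∈ S, Y m := by
    symm
    apply Finset.sum_subset (Finset.filter_subset _ _)
    intro m hm hmS
    simp only [Finset.mem_filter, hm, true_and, not_exists] at hmS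
    simp only [Y, P, Finset.card_eq_zero]
    exact Finset.filter_eq_empty_iff.2 fun u _ => hmS u
  have hsecond : ((∑ m ∈ Finset.univ.powersetCard l, Y m ^ 2 : ℕ) : ℝ) ≤
      N.choose l * (r ^ (2 * D) * (w ^ (2 * L₁) * (2 * L₁ + 1))) := by
    simp only [Y]
    rw [sum_card_filter_sq]
    have h1 := sum_pow_card_trail_union_le (L₁ := L₁) (L₂ := L₂) (κ := 1) hr0 le_rfl
      (by rw [one_mul]; exact hw) hL a
    rw [one_pow, mul_one] at h1
    push_cast
    calc _ ≤ ∑ u : Fin L₁ → Q, ∑ u' : Fin L₁ → Q,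
          (N.choose l : ℝ) * r ^ (trail L₂ a u ∪ trail L₂ a u').card := by
          refine Finset.sum_le_sum fun u _ => Finset.sum_le_sum fun u' _ => ?_
          simp_rw [P, ← Finset.disjoint_union_left, card_filter_disjoint_powersetCard, hN]
          exact choose_sub_le N l _ hN0 (by omega)
      _ ≤ _ := by
          simp_rw [← Finset.mul_sum]
          gcongr
  have hlow : (N.choose l : ℝ) * r ^ D / 2 ≤ (N - D).choose l := by
    have hDN : 4 * D ≤ N := le_trans (by nlinarith [Nat.le_self_pow (two_ne_zero) D]) hD
    refine le_trans ?_ (le_choose_sub N l D D le_rfl (by omega) hN0)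
    have h1 : (4 * (D : ℝ) ^ 2) ≤ N := by exact_mod_cast hD
    have hDN' : (4 * (D : ℝ)) ≤ N := by exact_mod_cast hDN
    have hb := one_add_mul_le_pow (a := -(2 * (D : ℝ) / N)) (by
      rw [neg_le_neg_iff, div_le_iff₀ hN']; linarith) D
    have h2 : (1 / 2 : ℝ) ≤ 1 + D * -(2 * (D : ℝ) / N) := by
      have : (D : ℝ) * (2 * (D : ℝ) / N) ≤ 1 / 2 := by
        rw [← mul_div_assoc, div_le_iff₀ hN']
        linarith
      linarith
    have h3 : r * (1 + -(2 * (D : ℝ) / N)) ≤ 1 - ((l : ℝ) + D) / N := by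
      rw [add_div]
      have : (D : ℝ) / N ≤ r * (2 * (D : ℝ) / N) := by
        have : (0 : ℝ) ≤ D / N := by positivity
        rw [mul_div_assoc]
        nlinarith
      linarith
    have h4 : (0 : ℝ) ≤ 1 + -(2 * (D : ℝ) / N) := by
      have : 2 * (D : ℝ) / N ≤ 1 := by rw [div_le_iff₀ hN']; linarith [show (0:ℝ) ≤ D by positivity]
      linarith
    calc (N.choose l : ℝ) * r ^ D / 2 = N.choose l * (r ^ D * (1 / 2)) := by ring
      _ ≤ N.choose l * (r ^ D * (1 + -(2 * (D : ℝ) / N)) ^ D) := by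
          gcongr
          exact h2.trans hb
      _ = N.choose l * (r * (1 + -(2 * (D : ℝ) / N))) ^ D := by rw [mul_pow]
      _ ≤ _ := by gcongr
  have hcs : ((∑ m ∈ S, Y m : ℕ) : ℝ) ^ 2 ≤
      S.card * ((∑ m ∈ Finset.univ.powersetCard l, Y m ^ 2 : ℕ) : ℝ) := by
    have h1 := sq_sum_le_card_mul_sum_sq (s := S) (f := Y)
    have h2 : ∑ m ∈ S, Y m ^ 2 ≤ ∑ m ∈ Finset.univ.powersetCard l, Y m ^ 2 :=
      Finset.sum_le_sum_of_subset (Finset.filter_subset _ _)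
    exact_mod_cast h1.trans (Nat.mul_le_mul_left _ h2)
  rw [← hsupp, hfirst] at hcs
  push_cast at hcs hsecond
  have hfin : (w ^ L₁ * (N.choose l * r ^ D / 2)) ^ 2 ≤
      S.card * (N.choose l * (r ^ (2 * D) * (w ^ (2 * L₁) * (2 * L₁ + 1)))) := by
    refine le_trans ?_ (hcs.trans ?_)
    · gcongr
    · gcongr
  have hpos : 0 < w ^ (2 * L₁) * r ^ (2 * D) * N.choose l := by positivity
  have : w ^ (2 * L₁) * r ^ (2 * D) * N.choose l * N.choose l ≤
      w ^ (2 * L₁) * r ^ (2 * D) * N.choose l * (4 * (2 * L₁ + 1) * S.card) := by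
    have e1 : w ^ (2 * L₁) = (w ^ L₁) ^ 2 := by rw [← pow_mul, mul_comm]
    have e2 : r ^ (2 * D) = (r ^ D) ^ 2 := by rw [← pow_mul, mul_comm]
    rw [e1, e2] at hfin ⊢
    linarith
  exact le_of_mul_le_mul_left this hpos

/-- Second moment bound for the number of labelled paths contained in a set whose size exceeds
`l` by the length of a path.  With `p = (l + L₁ * L₂) / N` and `θ = (N - l) / l`, the hypothesis
`hG` bounds `θ ^ (L₁ * L₂)` times the expected number of contained paths of one label; by `hA` the
pairs of paths with distinct labels do not dominate. -/
theorem sum_card_containedPaths_sq_le {l N : ℕ} (hN : Fintype.card (Slot A Q L₁ L₂) = N)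
    (hl : 0 < l) (hlN : 2 * l ≤ N) {G : ℝ}
    (hw : ((1 - (l : ℝ) / N)⁻¹) ^ L₂ ≤ Fintype.card Q) (hL : L₁ ^ 2 ≤ Fintype.card Q)
    (hD : l + L₁ * L₂ ≤ N)
    (hG : (Fintype.card Q : ℝ) ^ L₁ * (((l : ℝ) + L₁ * L₂) / N) ^ (L₁ * L₂) *
      (((N : ℝ) - l) / l) ^ (L₁ * L₂) ≤ G)
    (hA : (Fintype.card A : ℝ) ≤ (((N : ℝ) - l) / l) ^ (L₁ * L₂)) :
    ((∑ M ∈ Finset.univ.powersetCard (l + L₁ * L₂),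
        (containedPaths (A := A) (Q := Q) (L₁ := L₁) (L₂ := L₂) M).card ^ 2 : ℕ) : ℝ) ≤
      Fintype.card A * G ^ 2 * (2 * L₁ + 2) * N.choose l := by
  set D := L₁ * L₂ with hDdef
  have hN0 : 0 < N := by omega
  have hN' : (0 : ℝ) < N := by exact_mod_cast hN0
  have hl' : (0 : ℝ) < l := by exact_mod_cast hl
  have hlN' : 2 * (l : ℝ) ≤ N := by exact_mod_cast hlN
  have hDN' : (l : ℝ) + D ≤ N := by exact_mod_cast hD
  set θ : ℝ := ((N : ℝ) - l) / l with hθ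
  have hθ1 : 1 ≤ θ := by rw [hθ, le_div_iff₀ hl']; linarith
  have hθ0 : 0 < θ := by linarith
  set w : ℝ := (Fintype.card Q : ℝ) with hwdef
  set α : ℝ := (Fintype.card A : ℝ) with hα
  have hcastD : (L₁ : ℝ) * L₂ = D := by rw [hDdef]; push_cast; ring
  rw [hcastD] at hG
  set p : ℝ := ((l : ℝ) + D) / N with hp
  have hp0 : 0 < p := by positivity
  have hcount : ∀ B : Finset (Slot A Q L₁ L₂),
      ((((Finset.univ.powersetCard (l + D)).filter (fun M => B ⊆ M)).card : ℕ) : ℝ) ≤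
        N.choose (l + D) * p ^ B.card := by
    intro B
    rw [card_filter_subset_powersetCard B (by rw [hN]; exact hD), hN]
    refine (choose_sub_le N _ _ hN0 (Nat.sub_le _ _)).trans (le_of_eq ?_)
    rw [Nat.choose_symm hD, Nat.cast_sub hD]
    congr 2
    push_cast
    rw [hp]
    field_simp
    ring
  have hκ : (p⁻¹) ^ L₂ ≤ θ ^ L₂ * w := by
    have h1 : p⁻¹ ≤ θ * (1 - (l : ℝ) / N)⁻¹ := by
      have h2 : θ * (1 - (l : ℝ) / N)⁻¹ = (l / N : ℝ)⁻¹ := by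
        have : (N : ℝ) - l ≠ 0 := by linarith
        rw [hθ]
        field_simp
      rw [h2]
      apply inv_anti₀ (by positivity)
      rw [hp]
      gcongr
      linarith [show (0 : ℝ) ≤ D by positivity]
    calc (p⁻¹) ^ L₂ ≤ (θ * (1 - (l : ℝ) / N)⁻¹) ^ L₂ := by gcongr
      _ = θ ^ L₂ * ((1 - (l : ℝ) / N)⁻¹) ^ L₂ := mul_pow _ _ _
      _ ≤ _ := by gcongr
  have hsame : ∀ a : A, ∑ u : Fin L₁ → Q, ∑ u' : Fin L₁ → Q,
      p ^ (trail L₂ a u ∪ trail L₂ a u').card ≤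
      p ^ (2 * D) * (w ^ (2 * L₁) * θ ^ D * (2 * L₁ + 1)) := by
    intro a
    have := sum_pow_card_trail_union_le (L₁ := L₁) (L₂ := L₂) (κ := θ ^ L₂) hp0
      (one_le_pow₀ hθ1) hκ hL a
    rwa [← pow_mul, mul_comm L₂ L₁] at this
  have hdiff : ∀ a a' : A, a ≠ a' → ∑ u : Fin L₁ → Q, ∑ u' : Fin L₁ → Q,
      p ^ (trail L₂ a u ∪ trail L₂ a' u').card = p ^ (2 * D) * w ^ (2 * L₁) := by
    intro a a' h
    simp_rw [Finset.card_union_of_disjoint (disjoint_trail h _ _), card_trail, ← two_mul,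
      Finset.sum_const, Finset.card_univ, Fintype.card_fun, Fintype.card_fin]
    simp only [nsmul_eq_mul, Nat.cast_pow]
    ring
  set X := p ^ (2 * D) * w ^ (2 * L₁) with hX
  have hX0 : 0 ≤ X := by positivity
  have hX2 : X = (w ^ L₁ * p ^ D) ^ 2 := by rw [hX]; ring
  have hG0 : 0 ≤ w ^ L₁ * p ^ D * θ ^ D := by positivity
  have hG2 : X * θ ^ D * θ ^ D ≤ G ^ 2 := by
    calc X * θ ^ D * θ ^ D = (w ^ L₁ * p ^ D * θ ^ D) ^ 2 := by rw [hX2]; ring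
      _ ≤ G ^ 2 := by gcongr
  have htotal : ∑ a : A, ∑ a' : A, ∑ u : Fin L₁ → Q, ∑ u' : Fin L₁ → Q,
      p ^ (trail L₂ a u ∪ trail L₂ a' u').card ≤
      α * (X * θ ^ D * (2 * L₁ + 1)) + α * (α * X) := by
    calc _ ≤ ∑ a : A, ∑ a' : A, ((if a = a' then X * θ ^ D * (2 * L₁ + 1) else 0) + X) := by
          refine Finset.sum_le_sum fun a _ => Finset.sum_le_sum fun a' _ => ?_
          by_cases h : a = a'
          · subst h
            rw [if_pos rfl]
            refine (hsame a).trans (le_trans (le_of_eq ?_) (le_add_of_nonneg_right hX0))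
            rw [hX]
            ring
          · rw [hdiff a a' h, if_neg h, zero_add]
      _ = _ := by
          simp [Finset.sum_add_distrib, hα]
  unfold containedPaths
  rw [sum_card_filter_sq]
  push_cast
  calc _ ≤ ∑ x : A × (Fin L₁ → Q), ∑ y : A × (Fin L₁ → Q),
        (N.choose (l + D) : ℝ) * p ^ (trail L₂ x.1 x.2 ∪ trail L₂ y.1 y.2).card := by
        refine Finset.sum_le_sum fun x _ => Finset.sum_le_sum fun y _ => ?_
        simp_rw [← Finset.union_subset_iff]
        exact hcount _
    _ = N.choose (l + D) * ∑ a : A, ∑ a' : A, ∑ u : Fin L₁ → Q, ∑ u' : Fin L₁ → Q,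
        p ^ (trail L₂ a u ∪ trail L₂ a' u').card := by
        simp_rw [← Finset.mul_sum, Fintype.sum_prod_type]
        congr 1
        refine Finset.sum_congr rfl fun a _ => ?_
        rw [Finset.sum_comm]
    _ ≤ (N.choose l * θ ^ D) * (α * (X * θ ^ D * (2 * L₁ + 1)) + α * (α * X)) := by
        gcongr
        exact choose_add_le N l D hl (by omega)
    _ ≤ (N.choose l * θ ^ D) * (α * (X * θ ^ D * (2 * L₁ + 1)) + α * (θ ^ D * X)) := by
        gcongr
    _ = N.choose l * α * (2 * L₁ + 2) * (X * θ ^ D * θ ^ D) := by ring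
    _ ≤ N.choose l * α * (2 * L₁ + 2) * G ^ 2 := by gcongr
    _ = _ := by ring

end Count

/-! ### The layered graph inside the iterated matrix product -/

/-- The variables `z`: a copy of the slots for each side (left or right) of each of the `k`
blocks. -/
abbrev ZVar (A Q : Type*) (k L₁ L₂ : ℕ) := (Fin k × Bool) × Slot A Q L₁ L₂

/-- The variables `y`: a pair of labels (left and right) for each of the `k` blocks. -/
abbrev YVar (A : Type*) (k : ℕ) := Fin k × A × A

/-- The vertices of the layered graph: a label, the last two states of a path, and a coordinate
from `U` whose value in the middle of a two-layer gadget selects the matrix entry that carries a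
variable. -/
abbrev Vert (A Q U : Type*) := A × Q × Q × U

/-- The kinds of layers of the graph. -/
inductive Layer (k L₁ L₂ : ℕ) where
  | init : Layer k L₁ L₂
  | branch : Layer k L₁ L₂
  | spread (e : (Fin k × Bool) × Fin L₁ × Fin L₂) : Layer k L₁ L₂
  | gather (e : (Fin k × Bool) × Fin L₁ × Fin L₂) : Layer k L₁ L₂
  | link (i : Fin k) : Layer k L₁ L₂
  | final : Layer k L₁ L₂
  | pad : Layer k L₁ L₂

section Graph

variable {A Q U R : Type*} {k L₁ L₂ : ℕ}

/-- The variable that a path through the vertex `v` picks up in layer `e`. -/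
def slotAt (e : (Fin k × Bool) × Fin L₁ × Fin L₂) (v : Vert A Q U) : ZVar A Q k L₁ L₂ :=
  (e.1, v.1, e.2.1, e.2.2, v.2.1, v.2.2.1)

variable [DecidableEq A] [DecidableEq Q] [DecidableEq U] [Inhabited A] [Inhabited Q] [Inhabited U]
  [CommSemiring R]

/-- The transition matrix of a layer.  `init` leaves the base vertex to the start of any label,
`branch` moves to an arbitrary next state, `spread` followed by `gather` multiplies by the variable
of the current step (through the vertex selected by `τ`), `link` multiplies by a `y`-variable while
changing the label, and `final` returns to the base vertex. -/
def Layer.matrix (z : ZVar A Q k L₁ L₂ → R) (y : YVar A k → R) (τ : ZVar A Q k L₁ L₂ → U) :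
    Layer k L₁ L₂ → Matrix (Vert A Q U) (Vert A Q U) R
  | .init => fun v v' => if v = default ∧ v'.2 = default then 1 else 0
  | .branch => fun v v' =>
      if v'.1 = v.1 ∧ v'.2.1 = v.2.2.1 ∧ v'.2.2.2 = default then 1 else 0
  | .spread e => fun v v' =>
      if v.2.2.2 = default ∧ v' = (v.1, v.2.1, v.2.2.1, τ (slotAt e v)) then z (slotAt e v) else 0
  | .gather e => fun v v' =>
      if v.2.2.2 = τ (slotAt e v) ∧ v' = (v.1, v.2.1, v.2.2.1, default) then 1 else 0
  | .link i => fun v v' => if v'.2 = default then y (i, v.1, v'.1) else 0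
  | .final => fun _ v' => if v' = default then 1 else 0
  | .pad => 1

/-- The layers of one side of a block. -/
def sideLayers (L₁ L₂ : ℕ) (s : Fin k × Bool) : List (Layer k L₁ L₂) :=
  (List.finRange L₁).flatMap fun i => .branch ::
    (List.finRange L₂).flatMap fun j => [.spread (s, i, j), .gather (s, i, j)]

/-- The layers of one block. -/
def blockLayers (L₁ L₂ : ℕ) (i : Fin k) : List (Layer k L₁ L₂) :=
  .init :: (sideLayers L₁ L₂ (i, false) ++ .link i :: (sideLayers L₁ L₂ (i, true) ++ [.final]))

/-- The layers of the graph, without padding. -/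
def graphLayers (k L₁ L₂ : ℕ) : List (Layer k L₁ L₂) :=
  (List.finRange k).flatMap (blockLayers L₁ L₂)

theorem length_sideLayers (s : Fin k × Bool) :
    (sideLayers L₁ L₂ s).length = L₁ * (1 + 2 * L₂) := by
  simp [sideLayers, List.length_flatMap, mul_comm, add_comm]

theorem length_graphLayers : (graphLayers k L₁ L₂).length = k * (3 + 2 * (L₁ * (1 + 2 * L₂))) := by
  simp only [graphLayers, List.length_flatMap, blockLayers, List.length_cons, List.length_append,
    length_sideLayers, List.length_nil]
  simp
  left
  ring

theorem spread_mem_graphLayers (e : (Fin k × Bool) × Fin L₁ × Fin L₂) :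
    Layer.spread e ∈ graphLayers k L₁ L₂ := by
  obtain ⟨⟨i, b⟩, i₁, j⟩ := e
  cases b <;> simp [graphLayers, blockLayers, sideLayers]

theorem eq_of_spread_mem_sideLayers {s : Fin k × Bool} {e : (Fin k × Bool) × Fin L₁ × Fin L₂}
    (h : Layer.spread e ∈ sideLayers L₁ L₂ s) : e.1 = s := by
  simp only [sideLayers, List.mem_flatMap, List.mem_cons, List.mem_finRange, true_and,
    reduceCtorEq, false_or, Layer.spread.injEq, List.not_mem_nil, or_false] at h
  obtain ⟨i, j, rfl⟩ := h
  rfl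

theorem eq_of_spread_mem_blockLayers {i : Fin k} {e : (Fin k × Bool) × Fin L₁ × Fin L₂}
    (h : Layer.spread e ∈ blockLayers L₁ L₂ i) : e.1.1 = i := by
  simp only [blockLayers, List.mem_append, List.mem_cons, reduceCtorEq, false_or,
    List.not_mem_nil, or_false] at h
  rcases h with h | h <;> rw [eq_of_spread_mem_sideLayers h]

/-- Each `spread` layer occurs only once, so the candidate positions of different variables lie in
different places. -/
theorem pairwise_graphLayers : (graphLayers k L₁ L₂).Pairwise
    (fun a b => ∀ e, a = Layer.spread e → b ≠ Layer.spread e) := by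
  have hn : ∀ m, (List.finRange m).Pairwise (· ≠ ·) := List.nodup_finRange
  have hside : ∀ s : Fin k × Bool, (sideLayers L₁ L₂ s).Pairwise
      (fun a b => ∀ e, a = Layer.spread e → b ≠ Layer.spread e) := by
    intro s
    simp only [sideLayers, List.pairwise_flatMap]
    refine ⟨fun i _ => ?_, (hn L₁).imp fun {i i'} h => ?_⟩
    · rw [List.pairwise_cons]
      refine ⟨by simp, ?_⟩
      rw [List.pairwise_flatMap]
      refine ⟨by simp, (hn L₂).imp fun {j j'} h => ?_⟩
      rintro a ha b hb e rfl rfl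
      simp only [List.mem_cons, Layer.spread.injEq, reduceCtorEq, List.not_mem_nil,
        or_false] at ha hb
      rw [ha] at hb
      exact h (congrArg (fun e => e.2.2) hb)
    · rintro a ha b hb e rfl rfl
      simp only [List.mem_flatMap, List.mem_cons, List.mem_finRange, true_and,
        reduceCtorEq, false_or, Layer.spread.injEq, List.not_mem_nil, or_false] at ha hb
      obtain ⟨j, rfl⟩ := ha
      obtain ⟨j', hb⟩ := hb
      exact h (congrArg (fun e => e.2.1) hb)
  rw [graphLayers, List.pairwise_flatMap]
  refine ⟨fun i _ => ?_, (hn k).imp fun {i i'} h => ?_⟩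
  · rw [blockLayers, List.pairwise_cons, List.pairwise_append, List.pairwise_cons,
      List.pairwise_append]
    refine ⟨by simp, hside _, ⟨by simp, hside _, by simp, ?_⟩, ?_⟩
    · rintro a - b hb e rfl rfl
      simp at hb
    · rintro a ha b hb e rfl rfl
      simp only [List.mem_append, List.mem_cons, reduceCtorEq, false_or,
        List.not_mem_nil, or_false] at hb
      have h1 := eq_of_spread_mem_sideLayers ha
      rw [eq_of_spread_mem_sideLayers hb] at h1
      simp at h1
  · rintro a ha b hb e rfl rfl
    exact h ((eq_of_spread_mem_blockLayers ha).symm.trans (eq_of_spread_mem_blockLayers hb))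

/-! ### The polynomial computed by the layered graph -/

/-- The sum over all paths with label `a` of the product of the variables on the path. -/
def pathSum [Fintype Q] (z : ZVar A Q k L₁ L₂ → R) (s : Fin k × Bool) (a : A) : R :=
  ∑ u : Fin L₁ → Q, ∏ i, ∏ j, z (s, a, i, j, prevState default u i, u i)

variable [Fintype A] [Fintype Q] [Fintype U]
variable (z : ZVar A Q k L₁ L₂ → R) (y : YVar A k → R) (τ : ZVar A Q k L₁ L₂ → U)

theorem matrix_spread_mul_gather (e : (Fin k × Bool) × Fin L₁ × Fin L₂) :
    (Layer.spread e).matrix z y τ * (Layer.gather e).matrix z y τ =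
      Matrix.diagonal (fun v => if v.2.2.2 = default then z (slotAt e v) else 0) := by
  ext v v'
  rw [Matrix.mul_apply, Finset.sum_eq_single (v.1, v.2.1, v.2.2.1, τ (slotAt e v))]
  · simp only [Layer.matrix, Matrix.diagonal_apply]
    have h1 : slotAt e (v.1, v.2.1, v.2.2.1, τ (slotAt e v)) = slotAt e v := rfl
    simp only [h1, and_true, true_and]
    by_cases h2 : v.2.2.2 = default
    · have h3 : (v.1, v.2.1, v.2.2.1, (default : U)) = v := by rw [← h2]
      simp [h2, h3, eq_comm]
    · simp [h2]
  · intro b _ hb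
    simp [Layer.matrix, hb]
  · simp

/-- One step of a path: the next state is chosen and the `L₂` variables of the step are picked
up. -/
theorem mulVec_branch_step (s : Fin k × Bool) (i : Fin L₁) (ψ : Vert A Q U → R)
    (v : Vert A Q U) :
    Matrix.mulVec ((((Layer.branch :: (List.finRange L₂).flatMap
      fun j => [.spread (s, i, j), .gather (s, i, j)]).map (Layer.matrix z y τ))).prod) ψ v =
      ∑ x, (∏ j, z (s, v.1, i, j, v.2.2.1, x)) * ψ (v.1, v.2.2.1, x, default) := by
  have h1 : (((List.finRange L₂).flatMap
      fun j => [Layer.spread (s, i, j), .gather (s, i, j)]).map (Layer.matrix z y τ)).prod =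
      Matrix.diagonal (fun v => ∏ j : Fin L₂,
        if v.2.2.2 = default then z (slotAt (s, i, j) v) else 0) := by
    have h2 : ∀ l : List (Fin L₂), ((l.flatMap
      fun j => [Layer.spread (s, i, j), .gather (s, i, j)]).map (Layer.matrix z y τ)).prod =
      Matrix.diagonal (fun v => (l.map (fun j =>
        if v.2.2.2 = default then z (slotAt (s, i, j) v) else 0)).prod) := by
      intro l
      induction l with
      | nil => simp
      | cons j l ih =>
        rw [List.flatMap_cons, List.map_append, List.prod_append, ih]
        simp only [List.map_cons, List.map_nil, List.prod_cons, List.prod_nil, mul_one]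
        rw [matrix_spread_mul_gather, Matrix.diagonal_mul_diagonal]
    rw [h2]
    simp only [← List.ofFn_eq_map, List.prod_ofFn]
  rw [List.map_cons, List.prod_cons, h1, ← Matrix.mulVec_mulVec]
  have h3 : Matrix.mulVec (Matrix.diagonal (fun v : Vert A Q U => ∏ j : Fin L₂,
      if v.2.2.2 = default then z (slotAt (s, i, j) v) else 0)) ψ = fun v => (∏ j : Fin L₂,
      if v.2.2.2 = default then z (slotAt (s, i, j) v) else 0) * ψ v :=
    funext (Matrix.mulVec_diagonal _ _)
  rw [h3]
  simp only [Matrix.mulVec, dotProduct]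
  symm
  refine Fintype.sum_of_injective (fun x => (v.1, v.2.2.1, x, default)) ?_ _ _ ?_ ?_
  · intro x x' h
    simpa using h
  · rintro ⟨a, x, x', c⟩ h
    have : ¬ (a = v.1 ∧ x = v.2.2.1 ∧ c = default) := by
      rintro ⟨rfl, rfl, rfl⟩
      exact h ⟨x', rfl⟩
    simp [Layer.matrix, this]
  · intro x
    simp [Layer.matrix, slotAt]

theorem mulVec_sideLayers (s : Fin k × Bool) (ψ : Vert A Q U → R) (φ : A → R)
    (hψ : ∀ a x x', ψ (a, x, x', default) = φ a) (a : A) :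
    Matrix.mulVec (((sideLayers L₁ L₂ s).map (Layer.matrix z y τ)).prod) ψ
      (a, default, default, default) = pathSum z s a * φ a := by
  have key : ∀ (L : ℕ) (e : Fin L → Fin L₁) (x x' : Q),
      Matrix.mulVec ((((List.finRange L).flatMap fun i => Layer.branch ::
        (List.finRange L₂).flatMap fun j => [.spread (s, e i, j), .gather (s, e i, j)]).map
          (Layer.matrix z y τ)).prod) ψ (a, x, x', default) =
        (∑ u : Fin L → Q, ∏ i, ∏ j, z (s, a, e i, j, prevState x' u i, u i)) * φ a := by
    intro L
    induction L with
    | zero => intro e x x'; simp [hψ]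
    | succ L ih =>
      intro e x x'
      rw [List.finRange_succ, List.flatMap_cons, List.flatMap_map, List.map_append,
        List.prod_append, ← Matrix.mulVec_mulVec, mulVec_branch_step,
        sum_path_succ (fun i p q => ∏ j, z (s, a, e i, j, p, q)), Finset.sum_mul]
      refine Finset.sum_congr rfl fun c _ => ?_
      rw [ih (fun i => e i.succ), mul_assoc]
  exact key L₁ id default default

theorem mulVec_blockLayers (i : Fin k) (ψ : Vert A Q U → R) :
    Matrix.mulVec (((blockLayers L₁ L₂ i).map (Layer.matrix z y τ)).prod) ψ default =
      (∑ p : A × A, y (i, p) * (pathSum z (i, false) p.1 * pathSum z (i, true) p.2)) *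
        ψ default := by
  rw [blockLayers, List.map_cons, List.prod_cons, List.map_append, List.prod_append,
    List.map_cons, List.prod_cons, List.map_append, List.prod_append, List.map_singleton,
    List.prod_singleton]
  simp only [← Matrix.mulVec_mulVec]
  have hfinal : Matrix.mulVec ((Layer.final : Layer k L₁ L₂).matrix z y τ) ψ =
      fun _ => ψ default := by
    ext v
    simp [Matrix.mulVec, dotProduct, Layer.matrix]
  have hstart : ∀ (c : A → R) (f : Vert A Q U → R), ∑ v' : Vert A Q U,
      (if v'.2 = default then c v'.1 else 0) * f v' =
      ∑ b, c b * f (b, default) := by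
    intro c f
    symm
    refine Fintype.sum_of_injective (fun b : A => ((b, default) : Vert A Q U)) ?_ _ _ ?_ ?_
    · intro b b' h
      simpa using h
    · rintro ⟨b, t⟩ h
      have : t ≠ default := by rintro rfl; exact h ⟨b, rfl⟩
      simp [this]
    · intro b
      simp
  rw [hfinal]
  have hright : ∀ b : A, Matrix.mulVec (((sideLayers L₁ L₂ (i, true)).map
      (Layer.matrix z y τ)).prod) (fun _ : Vert A Q U => ψ default) (b, default) =
      pathSum z (i, true) b * ψ default :=
    fun b => mulVec_sideLayers z y τ (i, true) _ (fun _ => ψ default) (fun _ _ _ => rfl) b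
  have hleft : ∀ (f : Vert A Q U → R) (a : A), Matrix.mulVec (((sideLayers L₁ L₂ (i, false)).map
      (Layer.matrix z y τ)).prod) (Matrix.mulVec ((Layer.link i).matrix z y τ) f) (a, default) =
      pathSum z (i, false) a * ∑ b, y (i, a, b) * f (b, default) := by
    intro f a
    refine mulVec_sideLayers z y τ (i, false) _ (fun a => ∑ b, y (i, a, b) * f (b, default)) ?_ a
    intro a x x'
    simp only [Matrix.mulVec, dotProduct, Layer.matrix]
    exact hstart (fun b => y (i, a, b)) f
  have hinit : ∀ f : Vert A Q U → R,
      Matrix.mulVec ((Layer.init : Layer k L₁ L₂).matrix z y τ) f default =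
        ∑ a, f (a, default) := by
    intro f
    simp only [Matrix.mulVec, dotProduct, Layer.matrix, true_and]
    rw [hstart (fun _ => 1)]
    simp
  rw [hinit]
  simp only [hleft, hright, Fintype.sum_prod_type, Finset.mul_sum, Finset.sum_mul]
  refine Finset.sum_congr rfl fun a _ => Finset.sum_congr rfl fun b _ => ?_
  ring

theorem mulVec_graphLayers (ψ : Vert A Q U → R) :
    Matrix.mulVec (((graphLayers k L₁ L₂).map (Layer.matrix z y τ)).prod) ψ default =
      (∏ i, ∑ p : A × A, y (i, p) * (pathSum z (i, false) p.1 * pathSum z (i, true) p.2)) *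
        ψ default := by
  have key : ∀ l : List (Fin k),
      Matrix.mulVec (((l.flatMap (blockLayers L₁ L₂)).map (Layer.matrix z y τ)).prod) ψ default =
      (l.map (fun i => ∑ p : A × A,
        y (i, p) * (pathSum z (i, false) p.1 * pathSum z (i, true) p.2))).prod * ψ default := by
    intro l
    induction l with
    | nil => simp
    | cons i l ih =>
      rw [List.flatMap_cons, List.map_append, List.prod_append, ← Matrix.mulVec_mulVec,
        mulVec_blockLayers, ih, List.map_cons, List.prod_cons, mul_assoc]
  rw [graphLayers, key, ← List.ofFn_eq_map, List.prod_ofFn]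

end Graph

/-! ### Substituting the layered graph into the iterated matrix product -/

section Embedding

variable {R : Type*} [CommSemiring R]

theorem sum_path_mul_eq_mulVec {V : Type*} [Fintype V] [DecidableEq V] {d : ℕ}
    (M : Fin d → Matrix V V R) (ψ : V → R) (x : V) :
    ∑ u : Fin d → V, (∏ i, M i (prevState x u i) (u i)) *
        ψ ((Fin.cons x u : Fin (d + 1) → V) (Fin.last d)) =
      Matrix.mulVec (List.ofFn M).prod ψ x := by
  induction d generalizing x with
  | zero => simp
  | succ d ih =>
    rw [sum_fin_cons, List.ofFn_succ, List.prod_cons, ← Matrix.mulVec_mulVec]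
    simp only [Fin.prod_univ_succ, prevState_cons_zero, prevState_cons_succ, Fin.cons_zero,
      Fin.cons_succ, ← Fin.succ_last]
    rw [Matrix.mulVec, dotProduct]
    refine Finset.sum_congr rfl fun y _ => ?_
    rw [← ih, Finset.mul_sum]
    simp only [mul_assoc]

theorem aeval_iteratedMatMul {F : Type*} [CommSemiring F] [Algebra F R] {n d : ℕ}
    (M : Fin d → Matrix (Fin n) (Fin n) R) (o : Fin n) (ho : (o : ℕ) = 0) :
    MvPolynomial.aeval (fun x : Fin d × Fin n × Fin n => M x.1 x.2.1 x.2.2)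
        (iteratedMatMul F n d) =
      Matrix.mulVec (List.ofFn M).prod (fun i => if i = o then 1 else 0) o := by
  rw [← sum_path_mul_eq_mulVec]
  have hoi : ∀ i : Fin n, ((i : ℕ) = 0) ↔ i = o := fun i => by
    rw [Fin.ext_iff, ho]
  simp only [iteratedMatMul, map_sum, map_prod, MvPolynomial.aeval_X, hoi]
  rw [Finset.sum_filter, sum_fin_cons, Finset.sum_eq_single o]
  · refine Finset.sum_congr rfl fun u _ => ?_
    simp only [Fin.cons_zero, true_and, mul_ite, mul_one, mul_zero]
    rfl
  · intro b _ hb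
    simp [hb]
  · simp

/-- A matrix indexed by `V`, placed at the positions given by the injection `ι` and extended by
zero. -/
noncomputable def embedMatrix {V : Type*} {n : ℕ} (ι : V → Fin n) (M : Matrix V V R) :
    Matrix (Fin n) (Fin n) R :=
  fun i j => Function.extend (Prod.map ι ι) (fun p => M p.1 p.2) 0 (i, j)

theorem mulVec_prod_embedMatrix {V : Type*} [Fintype V] [DecidableEq V] {n : ℕ} {ι : V → Fin n}
    (hι : Function.Injective ι) (Ms : List (Matrix V V R)) (ψ : Fin n → R) (v : V) :
    Matrix.mulVec (Ms.map (embedMatrix ι)).prod ψ (ι v) = Matrix.mulVec Ms.prod (ψ ∘ ι) v := by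
  have hone : ∀ (M : Matrix V V R) (f : Fin n → R) (v : V),
      Matrix.mulVec (embedMatrix ι M) f (ι v) = Matrix.mulVec M (f ∘ ι) v := by
    intro M f v
    simp only [Matrix.mulVec, dotProduct]
    symm
    refine Fintype.sum_of_injective ι hι _ _ ?_ ?_
    · intro j hj
      rw [embedMatrix, Function.extend_apply', Pi.zero_apply, zero_mul]
      rintro ⟨⟨a, b⟩, hab⟩
      exact hj ⟨b, congrArg Prod.snd hab⟩
    · intro w
      have := (hι.prodMap hι).extend_apply (fun p : V × V => M p.1 p.2) 0 (v, w)
      rw [Prod.map_apply] at this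
      rw [embedMatrix, this]
      rfl
  induction Ms generalizing v with
  | nil => simp
  | cons M Ms ih =>
    rw [List.map_cons, List.prod_cons, List.prod_cons, ← Matrix.mulVec_mulVec,
      ← Matrix.mulVec_mulVec, hone]
    congr 1
    ext w
    exact ih w

end Embedding

section Substitution

variable {A Q U : Type*} [Fintype A] [Fintype Q] [Fintype U] [DecidableEq A] [DecidableEq Q]
  [DecidableEq U] [Inhabited A] [Inhabited Q] [Inhabited U]

theorem exists_injective_default {V : Type*} [Fintype V] [Inhabited V] {n : ℕ}
    (h : Fintype.card V ≤ n) :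
    ∃ ι : V → Fin n, Function.Injective ι ∧ (ι default : ℕ) = 0 := by
  classical
  have hn : 0 < n := lt_of_lt_of_le Fintype.card_pos h
  obtain ⟨f⟩ : Nonempty (V ↪ Fin n) := Function.Embedding.nonempty_of_card_le (by simpa using h)
  refine ⟨fun v => Equiv.swap (f default) ⟨0, hn⟩ (f v), fun v w hvw => ?_, by simp⟩
  exact f.injective ((Equiv.swap _ _).injective hvw)

/-- For every choice function `τ` there is a substitution of `0`, `1` and new variables into the
iterated matrix multiplication polynomial that produces the polynomial of the layered graph.  The
matrix entry that receives the variable `z` depends on `τ z` only, and it is one of `|U|` entries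
that are reserved for `z`. -/
theorem exists_substitution (F : Type*) [CommRing F] [Nontrivial F] {n d k L₁ L₂ : ℕ}
    (hn : Fintype.card (Vert A Q U) ≤ n) (hd : k * (3 + 2 * (L₁ * (1 + 2 * L₂))) ≤ d) :
    ∃ pos : ZVar A Q k L₁ L₂ × U → Fin d × Fin n × Fin n,
      ∃ σ : (ZVar A Q k L₁ L₂ → U) → Fin d × Fin n × Fin n →
          MvPolynomial (YVar A k) (MvPolynomial (ZVar A Q k L₁ L₂) F),
        (∀ τ z u, σ τ (pos (z, u)) = if τ z = u then MvPolynomial.C (MvPolynomial.X z) else 0) ∧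
        (∀ τ x, x ∉ Set.range pos → σ τ x = 0 ∨ σ τ x = 1 ∨ ∃ y, σ τ x = MvPolynomial.X y) ∧
        ∀ τ, MvPolynomial.aeval (σ τ) (iteratedMatMul F n d) =
          ∏ i, ∑ p : A × A, MvPolynomial.X (i, p) * MvPolynomial.C
            (pathSum MvPolynomial.X (i, false) p.1 * pathSum MvPolynomial.X (i, true) p.2) := by
  obtain ⟨ι, hι, hι0⟩ := exists_injective_default hn
  have hlen : (graphLayers k L₁ L₂).length ≤ d := length_graphLayers.trans_le hd
  let layer : Fin d → Layer k L₁ L₂ := fun l => (graphLayers k L₁ L₂).getD l .pad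
  have hlayer : List.ofFn layer =
      graphLayers k L₁ L₂ ++ List.replicate (d - (graphLayers k L₁ L₂).length) .pad := by
    apply List.ext_getElem
    · simp; omega
    · intro i h1 h2
      simp only [List.getElem_ofFn, layer, List.getD_eq_getElem?_getD]
      rcases Nat.lt_or_ge i (graphLayers k L₁ L₂).length with h | h
      · rw [List.getElem_append_left h, List.getElem?_eq_getElem h, Option.getD_some]
      · rw [List.getElem_append_right h, List.getElem?_eq_none h, Option.getD_none,
          List.getElem_replicate]
  have hspread : ∀ e, ∃ l, layer l = .spread e := by
    intro e
    obtain ⟨l, hl, hle⟩ := List.getElem_of_mem (spread_mem_graphLayers e)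
    exact ⟨⟨l, by omega⟩, by simp [layer, hl, hle]⟩
  have hspread_unique : ∀ e l l', layer l = .spread e → layer l' = .spread e → l = l' := by
    have hlt : ∀ e (l l' : Fin d), l < l' → layer l = .spread e → layer l' ≠ .spread e := by
      intro e l l' hll' hl hl'
      have hget : ∀ m : Fin d, layer m = .spread e → ∃ h : (m : ℕ) < (graphLayers k L₁ L₂).length,
          (graphLayers k L₁ L₂)[(m : ℕ)] = .spread e := by
        intro m hm
        rcases Nat.lt_or_ge m (graphLayers k L₁ L₂).length with h | h
        · exact ⟨h, by simpa [layer, h] using hm⟩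
        · simp [layer, h] at hm
      obtain ⟨h1, h2⟩ := hget l hl
      obtain ⟨h1', h2'⟩ := hget l' hl'
      exact List.pairwise_iff_getElem.1 pairwise_graphLayers l l' h1 h1' hll' e h2 h2'
    intro e l l' hl hl'
    rcases lt_trichotomy l l' with h | h | h
    · exact absurd hl' (hlt e l l' h hl)
    · exact h
    · exact absurd hl (hlt e l' l h hl')
  choose loc hloc using hspread
  let pos : ZVar A Q k L₁ L₂ × U → Fin d × Fin n × Fin n := fun p =>
    (loc (p.1.1, p.1.2.2.1, p.1.2.2.2.1),
      ι (p.1.2.1, p.1.2.2.2.2.1, p.1.2.2.2.2.2, default),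
      ι (p.1.2.1, p.1.2.2.2.2.1, p.1.2.2.2.2.2, p.2))
  let σ : (ZVar A Q k L₁ L₂ → U) → Fin d × Fin n × Fin n →
      MvPolynomial (YVar A k) (MvPolynomial (ZVar A Q k L₁ L₂) F) := fun τ x =>
    embedMatrix ι ((layer x.1).matrix (fun z => MvPolynomial.C (MvPolynomial.X z))
      MvPolynomial.X τ) x.2.1 x.2.2
  have hembed : ∀ (M : Matrix (Vert A Q U) (Vert A Q U)
      (MvPolynomial (YVar A k) (MvPolynomial (ZVar A Q k L₁ L₂) F))) (v v' : Vert A Q U),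
      embedMatrix ι M (ι v) (ι v') = M v v' := fun M v v' =>
    (hι.prodMap hι).extend_apply (fun p : Vert A Q U × Vert A Q U => M p.1 p.2) 0 (v, v')
  refine ⟨pos, σ, ?_, ?_, ?_⟩
  · rintro τ ⟨s, a, i, j, x, x'⟩ u
    simp only [σ, pos, hloc, hembed, Layer.matrix, slotAt, Prod.mk.injEq, true_and]
    simp only [eq_comm]
  · rintro τ ⟨l, i, j⟩ hx
    by_cases hij : ∃ v v', ι v = i ∧ ι v' = j
    · obtain ⟨v, v', rfl, rfl⟩ := hij
      simp only [σ, hembed]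
      cases hl : layer l with
      | init => simp only [Layer.matrix]; split_ifs <;> simp
      | branch => simp only [Layer.matrix]; split_ifs <;> simp
      | spread e =>
        left
        simp only [Layer.matrix]
        rw [if_neg]
        rintro ⟨h1, h2⟩
        refine hx ⟨(slotAt e v, v'.2.2.2), ?_⟩
        have hv : (v.1, v.2.1, v.2.2.1, (default : U)) = v := by rw [← h1]
        have hv' : (v.1, v.2.1, v.2.2.1, v'.2.2.2) = v' := by rw [h2]
        simp only [pos, slotAt, hv, hv']
        rw [hspread_unique _ _ _ (hloc _) hl]
      | gather e => simp only [Layer.matrix]; split_ifs <;> simp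
      | link i =>
        simp only [Layer.matrix]
        split_ifs
        · exact Or.inr (Or.inr ⟨_, rfl⟩)
        · exact Or.inl rfl
      | final => simp only [Layer.matrix]; split_ifs <;> simp
      | pad => simp only [Layer.matrix, Matrix.one_apply]; split_ifs <;> simp
    · left
      simp only [σ, embedMatrix]
      rw [Function.extend_apply', Pi.zero_apply]
      rintro ⟨⟨v, v'⟩, h⟩
      exact hij ⟨v, v', congrArg Prod.fst h, congrArg Prod.snd h⟩
  · intro τ
    let M : Fin d → Matrix (Fin n) (Fin n)
        (MvPolynomial (YVar A k) (MvPolynomial (ZVar A Q k L₁ L₂) F)) := fun l =>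
      embedMatrix ι ((layer l).matrix (fun z => MvPolynomial.C (MvPolynomial.X z))
        MvPolynomial.X τ)
    have h1 := aeval_iteratedMatMul (F := F) M (ι default) hι0
    have h2 : List.ofFn M =
        ((List.ofFn layer).map (Layer.matrix (fun z => MvPolynomial.C (MvPolynomial.X z))
          MvPolynomial.X τ)).map (embedMatrix ι) := by
      rw [List.map_ofFn, List.map_ofFn]
      rfl
    refine h1.trans ?_
    rw [h2, mulVec_prod_embedMatrix hι, hlayer, List.map_append, List.prod_append,
      List.map_replicate]
    simp only [Layer.matrix, List.prod_replicate, one_pow, mul_one]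
    rw [mulVec_graphLayers]
    simp only [Function.comp_apply, if_true, mul_one]
    refine Finset.prod_congr rfl fun i _ => Finset.sum_congr rfl fun p _ => ?_
    simp only [pathSum, map_mul, map_sum, map_prod]

end Substitution

/-! ### Restrictions that kill bottom gates with many variables -/

section Restriction

variable {F X Z U : Type*} [Fintype Z] [Fintype U]

open Classical in
/-- If every variable `z` survives in only one of `|U|` positions, chosen uniformly at random, then
a bottom gate with more than `s` of the variables `z` survives with probability at most
`|U|⁻⁽ˢ⁺¹⁾`; hence some choice kills all of these gates. -/
theorem exists_restriction (pos : Z × U → X) (Φ : DepthFourCircuit F X) (s : ℕ)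
    (h : Φ.numBottom < Fintype.card U ^ (s + 1)) :
    ∃ τ : Z → U, ∀ b, (∃ z u, CircuitLeaf.var (pos (z, u)) ∈ Φ.bottom b ∧ τ z ≠ u) ∨
      (Finset.univ.filter
        (fun z => CircuitLeaf.var (pos (z, τ z)) ∈ Φ.bottom b)).card ≤ s := by
  by_contra! hcon
  let Zb : Fin Φ.numBottom → Finset Z := fun b =>
    Finset.univ.filter (fun z => ∃ u, CircuitLeaf.var (pos (z, u)) ∈ Φ.bottom b)
  let bad : Fin Φ.numBottom → Finset (Z → U) := fun b => Finset.univ.filter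
    (fun τ => (∀ z u, CircuitLeaf.var (pos (z, u)) ∈ Φ.bottom b → τ z = u) ∧ s < (Zb b).card)
  have hcover : (Finset.univ : Finset (Z → U)) ⊆ Finset.univ.biUnion bad := by
    intro τ _
    obtain ⟨b, hb1, hb2⟩ := hcon τ
    simp only [Finset.mem_biUnion, Finset.mem_univ, true_and, bad, Finset.mem_filter]
    refine ⟨b, hb1, hb2.trans_le (Finset.card_le_card ?_)⟩
    intro z hz
    simp only [Finset.mem_filter, Finset.mem_univ, true_and, Zb] at hz ⊢
    exact ⟨_, hz⟩
  have hUpos : 0 < Fintype.card U := by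
    rcases Nat.eq_zero_or_pos (Fintype.card U) with h0 | h0
    · rw [h0] at h; simp at h
    · exact h0
  -- A gate with more than `s` of the variables survives only if `τ` takes prescribed values on
  -- them.
  have hbad : ∀ b, (bad b).card * Fintype.card U ^ (s + 1) ≤ Fintype.card U ^ Fintype.card Z := by
    intro b
    by_cases hs : s < (Zb b).card
    · have hex : ∀ z : Z, ∃ u, z ∈ Zb b → CircuitLeaf.var (pos (z, u)) ∈ Φ.bottom b := by
        intro z
        by_cases hz : z ∈ Zb b
        · obtain ⟨u, hu⟩ := (Finset.mem_filter.1 hz).2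
          exact ⟨u, fun _ => hu⟩
        · exact ⟨(Fintype.card_pos_iff.1 hUpos).some, fun h => absurd h hz⟩
      choose f hf using hex
      have hsub : bad b ⊆ Fintype.piFinset (fun z => if z ∈ Zb b then {f z} else Finset.univ) := by
        intro τ hτ
        rw [Fintype.mem_piFinset]
        intro z
        split_ifs with hz
        · rw [Finset.mem_singleton]
          exact (Finset.mem_filter.1 hτ).2.1 z _ (hf z hz)
        · exact Finset.mem_univ _
      have hcard : (Fintype.piFinset (fun z => if z ∈ Zb b then {f z} else Finset.univ)).card *
          Fintype.card U ^ (Zb b).card = Fintype.card U ^ Fintype.card Z := by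
        rw [Fintype.card_piFinset]
        have h1 : ∀ z, (if z ∈ Zb b then ({f z} : Finset U) else Finset.univ).card =
            if z ∈ Zb b then 1 else Fintype.card U := by
          intro z
          split_ifs <;> simp
        simp only [h1]
        rw [Finset.prod_ite, Finset.prod_const_one, one_mul, Finset.prod_const, ← pow_add]
        congr 1
        rw [Finset.filter_not, Finset.filter_mem_eq_inter, Finset.univ_inter,
          Finset.card_sdiff_add_card_eq_card (Finset.subset_univ _), Finset.card_univ]
      calc (bad b).card * Fintype.card U ^ (s + 1)
          ≤ _ * Fintype.card U ^ (Zb b).card :=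
            Nat.mul_le_mul (Finset.card_le_card hsub) (Nat.pow_le_pow_right hUpos hs)
        _ = _ := hcard
    · have : bad b = ∅ := by
        apply Finset.filter_eq_empty_iff.2
        intro τ _ hτ
        exact hs hτ.2
      simp [this]
  have h1 : Fintype.card U ^ Fintype.card Z ≤ ∑ b, (bad b).card := by
    calc Fintype.card U ^ Fintype.card Z = (Finset.univ : Finset (Z → U)).card := by
          rw [Finset.card_univ, Fintype.card_fun]
      _ ≤ (Finset.univ.biUnion bad).card := Finset.card_le_card hcover
      _ ≤ _ := Finset.card_biUnion_le
  have h2 : Fintype.card U ^ Fintype.card Z * Fintype.card U ^ (s + 1) ≤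
      Fintype.card U ^ Fintype.card Z * Φ.numBottom := by
    calc _ ≤ (∑ b, (bad b).card) * Fintype.card U ^ (s + 1) := Nat.mul_le_mul_right _ h1
      _ = ∑ b, (bad b).card * Fintype.card U ^ (s + 1) := Finset.sum_mul _ _ _
      _ ≤ ∑ _b : Fin Φ.numBottom, Fintype.card U ^ Fintype.card Z :=
          Finset.sum_le_sum fun b _ => hbad b
      _ = _ := by simp [mul_comm]
  exact absurd (Nat.le_of_mul_le_mul_left h2 (by positivity)) (not_le.2 h)

end Restriction

/-! ### Coefficients of products of polynomials of small support -/

section Coefficients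

variable {F Y Z : Type*} [Field F]

/-- The span of the monomials with at most `t` variables. -/
noncomputable def smallSupport (F Z : Type*) [Field F] (t : ℕ) : Submodule F (MvPolynomial Z F) :=
  Submodule.span F {g | ∃ e : Z →₀ ℕ, e.support.card ≤ t ∧ g = MvPolynomial.monomial e 1}

theorem smallSupport_mono {t t' : ℕ} (h : t ≤ t') : smallSupport F Z t ≤ smallSupport F Z t' :=
  Submodule.span_mono fun _ ⟨e, he, hg⟩ => ⟨e, he.trans h, hg⟩

theorem monomial_mem_smallSupport {t : ℕ} {e : Z →₀ ℕ} (he : e.support.card ≤ t) (c : F) :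
    MvPolynomial.monomial e c ∈ smallSupport F Z t := by
  have : MvPolynomial.monomial e c = c • MvPolynomial.monomial e (1 : F) := by
    rw [MvPolynomial.smul_monomial, smul_eq_mul, mul_one]
  rw [this]
  exact Submodule.smul_mem _ _ (Submodule.subset_span ⟨e, he, rfl⟩)

theorem smallSupport_mul_le (t t' : ℕ) :
    smallSupport F Z t * smallSupport F Z t' ≤ smallSupport F Z (t + t') := by
  classical
  rw [smallSupport, smallSupport, Submodule.span_mul_span, Submodule.span_le]
  rintro _ ⟨_, ⟨e, he, rfl⟩, _, ⟨e', he', rfl⟩, rfl⟩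
  simp only [MvPolynomial.monomial_mul, mul_one]
  refine monomial_mem_smallSupport ?_ 1
  calc (e + e').support.card ≤ (e.support ∪ e'.support).card :=
        Finset.card_le_card Finsupp.support_add
    _ ≤ _ := (Finset.card_union_le _ _).trans (Nat.add_le_add he he')

/-- The coefficient of a monomial of degree at most `j` in a product: all but at most `j` of the
flagged factors contribute their constant coefficient, and the unflagged factors contribute
scalars.  So these coefficients are products of a polynomial of small support with one of few
fixed polynomials. -/
theorem exists_coeff_prod_mem {ι : Type*} (s : ℕ) (h : ι → MvPolynomial Y (MvPolynomial Z F))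
    (flag : ι → Prop) [DecidablePred flag] (m : Multiset ι)
    (hs : ∀ i ∈ m, ∀ T, MvPolynomial.coeff T (h i) ∈ smallSupport F Z s)
    (hf : ∀ i ∈ m, ¬ flag i → ∀ T, MvPolynomial.coeff T (h i) ∈ smallSupport F Z 0) (j : ℕ) :
    ∃ P : Finset (MvPolynomial Z F), P.card ≤ (m.countP flag + 1) ^ j ∧
      ∀ T : Y →₀ ℕ, T.degree ≤ j → MvPolynomial.coeff T (m.map h).prod ∈
        smallSupport F Z (s * j) * Submodule.span F (P : Set (MvPolynomial Z F)) := by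
  classical
  induction m using Multiset.induction_on generalizing j with
  | empty =>
    refine ⟨{1}, by simp, fun T _ => ?_⟩
    rw [Multiset.map_zero, Multiset.prod_zero, MvPolynomial.coeff_one]
    split_ifs
    · have : (1 : MvPolynomial Z F) = 1 * 1 := (one_mul 1).symm
      rw [this]
      refine Submodule.mul_mem_mul ?_ (Submodule.subset_span (by simp))
      exact monomial_mem_smallSupport (e := 0) (by simp) 1
    · exact Submodule.zero_mem _
  | cons i m ih =>
    have ih' := ih (fun i' hi' => hs i' (Multiset.mem_cons_of_mem hi'))
      (fun i' hi' => hf i' (Multiset.mem_cons_of_mem hi'))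
    have hs' := hs i (Multiset.mem_cons_self i m)
    have hf' := hf i (Multiset.mem_cons_self i m)
    set c := MvPolynomial.coeff 0 (h i) with hc
    have himage : ∀ (t : ℕ) (P : Finset (MvPolynomial Z F)) (v : MvPolynomial Z F),
        v ∈ smallSupport F Z t * Submodule.span F (P : Set (MvPolynomial Z F)) →
        c * v ∈ smallSupport F Z t *
          Submodule.span F ((P.image (c * ·) : Finset _) : Set (MvPolynomial Z F)) := by
      intro t P v hv
      refine Submodule.mul_induction_on hv (fun a ha b hb => ?_) (fun a b ha hb => ?_)
      · rw [mul_left_comm]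
        refine Submodule.mul_mem_mul ha ?_
        have h1 := Submodule.mem_map_of_mem (f := LinearMap.mulLeft F c) hb
        rw [← Submodule.span_image] at h1
        rw [Finset.coe_image]
        exact h1
      · rw [mul_add]
        exact Submodule.add_mem _ ha hb
    by_cases hflag : flag i
    · rcases j with _ | j
      · obtain ⟨P, hP, hmem⟩ := ih' 0
        refine ⟨P.image (c * ·), ?_, ?_⟩
        · exact Finset.card_image_le.trans (by simpa using hP)
        · intro T hT
          have hT0 : T = 0 := by
            rwa [Nat.le_zero, Finsupp.degree_eq_zero_iff] at hT
          subst hT0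
          rw [Multiset.map_cons, Multiset.prod_cons, MvPolynomial.coeff_mul,
            Finset.HasAntidiagonal.antidiagonal_zero, Finset.sum_singleton]
          exact himage _ _ _ (hmem 0 hT)
      · obtain ⟨P, hP, hmem⟩ := ih' (j + 1)
        obtain ⟨P', hP', hmem'⟩ := ih' j
        refine ⟨P.image (c * ·) ∪ P', ?_, ?_⟩
        · rw [Multiset.countP_cons_of_pos _ hflag]
          calc _ ≤ P.card + P'.card := (Finset.card_union_le _ _).trans
                (Nat.add_le_add_right Finset.card_image_le _)
            _ ≤ (m.countP flag + 1) ^ (j + 1) + (m.countP flag + 1) ^ j := Nat.add_le_add hP hP'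
            _ = (m.countP flag + 1) ^ j * (m.countP flag + 1 + 1) := by ring
            _ ≤ (m.countP flag + 1 + 1) ^ j * (m.countP flag + 1 + 1) := by
                gcongr
                omega
            _ = _ := by ring
        · intro T hT
          rw [Multiset.map_cons, Multiset.prod_cons, MvPolynomial.coeff_mul]
          refine Submodule.sum_mem _ fun x hx => ?_
          rw [Finset.HasAntidiagonal.mem_antidiagonal] at hx
          rw [← hx, map_add] at hT
          by_cases hx1 : x.1 = 0
          · rw [hx1]
            refine SetLike.le_def.1 (mul_le_mul' le_rfl ?_) (himage _ _ _ (hmem x.2 (by omega)))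
            apply Submodule.span_mono
            rw [Finset.coe_union]
            exact Set.subset_union_left
          · have h1 : x.1.degree ≠ 0 := fun h => hx1 (Finsupp.degree_eq_zero_iff _ |>.1 h)
            have h2 := Submodule.mul_mem_mul (hs' x.1) (hmem' x.2 (by omega))
            rw [← mul_assoc] at h2
            refine SetLike.le_def.1 (mul_le_mul' ?_ ?_) h2
            · refine (smallSupport_mul_le s (s * j)).trans (smallSupport_mono ?_)
              rw [mul_add, mul_one, add_comm]
            · apply Submodule.span_mono
              rw [Finset.coe_union]
              exact Set.subset_union_right
    · obtain ⟨P, hP, hmem⟩ := ih' j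
      refine ⟨P, by rwa [Multiset.countP_cons_of_neg _ hflag], fun T hT => ?_⟩
      rw [Multiset.map_cons, Multiset.prod_cons, MvPolynomial.coeff_mul]
      refine Submodule.sum_mem _ fun x hx => ?_
      rw [Finset.HasAntidiagonal.mem_antidiagonal] at hx
      have h1 : x.2.degree ≤ j := by
        rw [← hx, map_add] at hT
        omega
      have h2 := Submodule.mul_mem_mul (hf' hflag x.1) (hmem x.2 h1)
      rw [← mul_assoc] at h2
      have h3 := smallSupport_mul_le (F := F) (Z := Z) 0 (s * j)
      rw [zero_add] at h3
      exact SetLike.le_def.1 (mul_le_mul' h3 le_rfl) h2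

end Coefficients

/-! ### The circuit after the substitution -/

section Circuit

variable {F X Y Z U : Type*} [Field F]

open Classical in
theorem countP_exists_le_sum {ι : Type*} [Fintype Z] (p : Z → ι → Prop) (m : Multiset ι) :
    m.countP (fun i => ∃ z, p z i) ≤ ∑ z, m.countP (p z) := by
  induction m using Multiset.induction_on with
  | empty => simp
  | cons i m ih =>
    by_cases h : ∃ z, p z i
    · obtain ⟨z, hz⟩ := h
      rw [Multiset.countP_cons_of_pos _ ⟨z, hz⟩]
      have h1 : ∑ z, m.countP (p z) < ∑ z, (i ::ₘ m).countP (p z) := by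
        refine Finset.sum_lt_sum (fun z _ => Multiset.countP_le_of_le _ (Multiset.le_cons_self _ _))
          ⟨z, Finset.mem_univ _, ?_⟩
        rw [Multiset.countP_cons_of_pos _ hz]
        exact Nat.lt_succ_self _
      omega
    · rw [Multiset.countP_cons_of_neg (p := fun i => ∃ z, p z i) _ h]
      exact ih.trans (Finset.sum_le_sum fun z _ =>
        Multiset.countP_le_of_le _ (Multiset.le_cons_self _ _))

variable (pos : Z × U → X) (τ : Z → U) (σ : X → MvPolynomial Y (MvPolynomial Z F))

/-- The substitution maps leaves to monomials, so a product of leaves becomes a single monomial; its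
`z`-part involves only variables `z` that occur at the position selected by `τ`. -/
theorem aeval_prod_leaves [DecidableEq U]
    (hpos : ∀ z u, σ (pos (z, u)) = if τ z = u then MvPolynomial.C (MvPolynomial.X z) else 0)
    (hrest : ∀ x, x ∉ Set.range pos → σ x = 0 ∨ σ x = 1 ∨ ∃ y, σ x = MvPolynomial.X y)
    (m : Multiset (CircuitLeaf F X)) :
    ∃ (α : Y →₀ ℕ) (e : Z →₀ ℕ) (c : F),
      MvPolynomial.aeval σ (m.map CircuitLeaf.poly).prod =
        MvPolynomial.monomial α (MvPolynomial.monomial e c) ∧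
      ∀ z ∈ e.support, CircuitLeaf.var (pos (z, τ z)) ∈ m := by
  classical
  induction m using Multiset.induction_on with
  | empty =>
    exact ⟨0, 0, 1, by simp [← MvPolynomial.C_apply], by simp⟩
  | cons l m ih =>
    obtain ⟨α, e, c, h1, h2⟩ := ih
    have h2' : ∀ z ∈ e.support, CircuitLeaf.var (pos (z, τ z)) ∈ l ::ₘ m :=
      fun z hz => Multiset.mem_cons_of_mem (h2 z hz)
    rw [Multiset.map_cons, Multiset.prod_cons, map_mul, h1]
    have hzero : MvPolynomial.aeval σ l.poly = 0 → ∃ (α' : Y →₀ ℕ) (e' : Z →₀ ℕ) (c' : F),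
        MvPolynomial.aeval σ l.poly * MvPolynomial.monomial α (MvPolynomial.monomial e c) =
          MvPolynomial.monomial α' (MvPolynomial.monomial e' c') ∧
        ∀ z ∈ e'.support, CircuitLeaf.var (pos (z, τ z)) ∈ l ::ₘ m := by
      intro h
      -- The zero monomial has the empty support by choice of its exponents.
      exact ⟨0, 0, 0, by simp [h], by simp⟩
    cases l with
    | const a =>
      refine ⟨α, e, a * c, ?_, h2'⟩
      rw [CircuitLeaf.poly, MvPolynomial.aeval_C,
        IsScalarTower.algebraMap_apply F (MvPolynomial Z F), MvPolynomial.algebraMap_eq,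
        MvPolynomial.algebraMap_eq, MvPolynomial.C_mul_monomial, MvPolynomial.C_mul_monomial]
    | var x =>
      rw [CircuitLeaf.poly, MvPolynomial.aeval_X] at hzero ⊢
      by_cases hx : x ∈ Set.range pos
      · obtain ⟨⟨z, u⟩, rfl⟩ := hx
        by_cases hu : τ z = u
        · subst hu
          refine ⟨α, Finsupp.single z 1 + e, c, ?_, ?_⟩
          · rw [hpos, if_pos rfl, MvPolynomial.C_mul_monomial, MvPolynomial.X,
              MvPolynomial.monomial_mul, one_mul]
          · intro z' hz'
            rcases Finset.mem_union.1 (Finsupp.support_add hz') with h | h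
            · have : z' = z := by
                have := Finsupp.support_single_subset h
                simpa using this
              subst this
              exact Multiset.mem_cons_self _ _
            · exact h2' z' h
        · exact hzero (by rw [hpos, if_neg hu])
      · rcases hrest x hx with h | h | ⟨y, h⟩
        · exact hzero h
        · exact ⟨α, e, c, by rw [h, one_mul], h2'⟩
        · refine ⟨Finsupp.single y 1 + α, e, c, ?_, h2'⟩
          rw [h, MvPolynomial.X, MvPolynomial.monomial_mul, one_mul]

open Classical in
/-- The coefficients, with respect to the variables `y`, of the polynomial computed by a
syntactically multi-`δ`-ic depth four circuit after a substitution which leaves only bottom gates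
with at most `s` of the variables `z`. -/
theorem exists_coeff_eval_mem [Fintype Z]
    (hpos : ∀ z u, σ (pos (z, u)) = if τ z = u then MvPolynomial.C (MvPolynomial.X z) else 0)
    (hrest : ∀ x, x ∉ Set.range pos → σ x = 0 ∨ σ x = 1 ∨ ∃ y, σ x = MvPolynomial.X y)
    {Φ : DepthFourCircuit F X} {δ s : ℕ} (hΦ : Φ.SyntacticallyMultiIc δ)
    (hs : ∀ b, (∃ z u, CircuitLeaf.var (pos (z, u)) ∈ Φ.bottom b ∧ τ z ≠ u) ∨
      (Finset.univ.filter
        (fun z => CircuitLeaf.var (pos (z, τ z)) ∈ Φ.bottom b)).card ≤ s) (j : ℕ) :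
    ∃ P : Finset (MvPolynomial Z F), P.card ≤ Φ.numTop * (δ * Fintype.card Z + 1) ^ j ∧
      ∀ T : Y →₀ ℕ, T.degree ≤ j → MvPolynomial.coeff T (MvPolynomial.aeval σ Φ.eval) ∈
        smallSupport F Z (s * j) * Submodule.span F (P : Set (MvPolynomial Z F)) := by
  have hbottom : ∀ b t T, (Finset.univ.filter
        (fun z => CircuitLeaf.var (pos (z, τ z)) ∈ Φ.bottom b)).card ≤ t →
      MvPolynomial.coeff T (MvPolynomial.aeval σ (Φ.bottomPoly b)) ∈ smallSupport F Z t := by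
    intro b t T ht
    obtain ⟨α, e, c, h1, h2⟩ := aeval_prod_leaves pos τ σ hpos hrest (Φ.bottom b)
    rw [DepthFourCircuit.bottomPoly, h1, MvPolynomial.coeff_monomial]
    split_ifs
    · refine monomial_mem_smallSupport (le_trans (Finset.card_le_card fun z hz => ?_) ht) c
      exact Finset.mem_filter.2 ⟨Finset.mem_univ _, h2 z hz⟩
    · exact Submodule.zero_mem _
  have hdead : ∀ b, (∃ z u, CircuitLeaf.var (pos (z, u)) ∈ Φ.bottom b ∧ τ z ≠ u) →
      MvPolynomial.aeval σ (Φ.bottomPoly b) = 0 := by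
    rintro b ⟨z, u, hb, hu⟩
    rw [DepthFourCircuit.bottomPoly, map_multiset_prod, Multiset.prod_eq_zero_iff,
      Multiset.map_map, Multiset.mem_map]
    exact ⟨_, hb, by
      rw [Function.comp_apply, CircuitLeaf.poly, MvPolynomial.aeval_X, hpos, if_neg hu]⟩
  have hmiddle : ∀ g t, (∀ b ∈ Φ.middle g, ∀ T,
      MvPolynomial.coeff T (MvPolynomial.aeval σ (Φ.bottomPoly b)) ∈ smallSupport F Z t) →
      ∀ T, MvPolynomial.coeff T (MvPolynomial.aeval σ (Φ.middlePoly g)) ∈ smallSupport F Z t := by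
    intro g t h T
    rw [DepthFourCircuit.middlePoly, map_multiset_sum]
    change MvPolynomial.coeffAddMonoidHom T _ ∈ _
    rw [map_multiset_sum, Multiset.map_map, Multiset.map_map]
    refine multiset_sum_mem _ fun v hv => ?_
    obtain ⟨b, hb, rfl⟩ := Multiset.mem_map.1 hv
    exact h b hb T
  -- The operands in which a surviving variable `z` appears: by the multi-`δ`-ic condition there are
  -- at most `δ * |Z|` of them at every top product gate.
  let flag : Fin Φ.numMiddle → Prop := fun g => ∃ z, Φ.AppearsMiddle (pos (z, τ z)) g
  have htop : ∀ g, ∃ P : Finset (MvPolynomial Z F), P.card ≤ (δ * Fintype.card Z + 1) ^ j ∧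
      ∀ T : Y →₀ ℕ, T.degree ≤ j → MvPolynomial.coeff T (MvPolynomial.aeval σ (Φ.topPoly g)) ∈
        smallSupport F Z (s * j) * Submodule.span F (P : Set (MvPolynomial Z F)) := by
    intro g
    obtain ⟨P, hP, hmem⟩ := exists_coeff_prod_mem s
      (fun u => MvPolynomial.aeval σ (Φ.middlePoly u)) flag (Φ.top g)
      (fun u _ => hmiddle u s fun b _ T => by
        rcases hs b with h | h
        · rw [hdead b h, MvPolynomial.coeff_zero]
          exact Submodule.zero_mem _
        · exact hbottom b s T h)
      (fun u _ hu => hmiddle u 0 fun b hb T => by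
        refine hbottom b 0 T ?_
        rw [Nat.le_zero, Finset.card_eq_zero]
        refine Finset.filter_eq_empty_iff.2 fun z _ hz => hu ⟨z, b, hb, _, hz, rfl⟩) j
    refine ⟨P, hP.trans (Nat.pow_le_pow_left (Nat.succ_le_succ ?_) j), fun T hT => ?_⟩
    · calc (Φ.top g).countP flag
          ≤ ∑ z, (Φ.top g).countP (fun u => Φ.AppearsMiddle (pos (z, τ z)) u) :=
            countP_exists_le_sum _ _
        _ ≤ ∑ _z : Z, δ := Finset.sum_le_sum fun z _ => ((hΦ (pos (z, τ z))).2 g).1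
        _ = δ * Fintype.card Z := by simp [mul_comm]
    · rw [DepthFourCircuit.topPoly, map_multiset_prod, Multiset.map_map]
      exact hmem T hT
  choose P hP hmem using htop
  refine ⟨Finset.univ.biUnion P, ?_, fun T hT => ?_⟩
  · calc _ ≤ ∑ g, (P g).card := Finset.card_biUnion_le
      _ ≤ ∑ _g : Fin Φ.numTop, (δ * Fintype.card Z + 1) ^ j := Finset.sum_le_sum fun g _ => hP g
      _ = _ := by simp
  · rw [DepthFourCircuit.eval, map_multiset_sum]
    change MvPolynomial.coeffAddMonoidHom T _ ∈ _
    rw [map_multiset_sum, Multiset.map_map, Multiset.map_map]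
    refine multiset_sum_mem _ fun v hv => ?_
    obtain ⟨g, hg, rfl⟩ := Multiset.mem_map.1 hv
    refine SetLike.le_def.1 (mul_le_mul' le_rfl ?_) (hmem g T hT)
    apply Submodule.span_mono
    exact_mod_cast Finset.subset_biUnion_of_mem P (Finset.mem_univ g)

end Circuit

/-! ### Projection onto multilinear monomials -/

section Projection

variable {K V F : Type*} [Fintype K] [Fintype V] [DecidableEq V] [Field F]

/-- The exponent vector of the multilinear monomial whose variables on the side `κ` are `M κ`. -/
noncomputable def multilinearExponent (M : K → Finset V) : K × V →₀ ℕ :=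
  Finsupp.equivFunOnFinite.symm (fun z => if z.2 ∈ M z.1 then 1 else 0)

theorem multilinearExponent_apply (M : K → Finset V) (z : K × V) :
    multilinearExponent M z = if z.2 ∈ M z.1 then 1 else 0 := rfl

theorem multilinearExponent_injective :
    Function.Injective (multilinearExponent : (K → Finset V) → K × V →₀ ℕ) := by
  intro M M' h
  funext κ
  ext x
  have h1 := DFunLike.congr_fun h (κ, x)
  simp only [multilinearExponent_apply] at h1
  by_cases h2 : x ∈ M κ <;> by_cases h3 : x ∈ M' κ <;> simp_all

theorem prod_prod_X_eq_monomial (M : K → Finset V) :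
    ∏ κ, ∏ x ∈ M κ, (MvPolynomial.X (κ, x) : MvPolynomial (K × V) F) =
      MvPolynomial.monomial (multilinearExponent M) 1 := by
  classical
  rw [MvPolynomial.monomial_eq, MvPolynomial.C_1, one_mul, Finsupp.prod_fintype _ _ (by simp),
    Fintype.prod_prod_type]
  refine Finset.prod_congr rfl fun κ _ => ?_
  simp only [multilinearExponent_apply, pow_ite, pow_one, pow_zero]
  rw [Finset.prod_ite_mem, Finset.univ_inter]

/-- The projection of a polynomial onto its multilinear part, as a vector of coefficients. -/
noncomputable def multilinearPart (K V F : Type*) [Fintype K] [Fintype V] [DecidableEq V]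
    [Field F] : MvPolynomial (K × V) F →ₗ[F] ((K → Finset V) → F) :=
  LinearMap.pi (fun M => MvPolynomial.lcoeff F (multilinearExponent M))

theorem multilinearPart_apply (g : MvPolynomial (K × V) F) (M : K → Finset V) :
    multilinearPart K V F g M = MvPolynomial.coeff (multilinearExponent M) g := rfl

open Classical in
/-- The families of sets that have at least `l` elements on every side and at most `t` elements
more than that in total. -/
noncomputable def nearLevel (K V : Type*) [Fintype K] [Fintype V] (l t : ℕ) :
    Finset (K → Finset V) :=
  Finset.univ.filter (fun M => (∀ κ, l ≤ (M κ).card) ∧ ∑ κ, ((M κ).card - l) ≤ t)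

theorem sum_multilinearExponent (M : K → Finset V) :
    ∑ z, multilinearExponent M z = ∑ κ, (M κ).card := by
  rw [Fintype.sum_prod_type]
  refine Finset.sum_congr rfl fun κ _ => ?_
  simp [multilinearExponent_apply]

/-- A monomial with at most `t` variables, times a multilinear monomial, has a square factor or is
multilinear, whatever its degree; in the second case the set of variables grows by at most `t`. -/
theorem multilinearPart_shift_mem_span {l t : ℕ} (m : K → Finset V) (hm : ∀ κ, (m κ).card = l)
    (P : Finset (MvPolynomial (K × V) F)) {g : MvPolynomial (K × V) F}
    (hg : g ∈ smallSupport F (K × V) t * Submodule.span F (P : Set (MvPolynomial (K × V) F))) :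
    multilinearPart K V F (MvPolynomial.monomial (multilinearExponent m) 1 * g) ∈
      Submodule.span F ((fun q : (K → Finset V) × MvPolynomial (K × V) F =>
        multilinearPart K V F (MvPolynomial.monomial (multilinearExponent q.1) 1 * q.2)) ''
          (nearLevel K V l t ×ˢ P : Finset _)) := by
  classical
  rw [smallSupport, Submodule.span_mul_span] at hg
  have h1 := Submodule.mem_map_of_mem (f := (multilinearPart K V F).comp
    (LinearMap.mulLeft F (MvPolynomial.monomial (multilinearExponent m) 1))) hg
  refine SetLike.le_def.1 ?_ h1
  rw [Submodule.map_span_le]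
  rintro _ ⟨_, ⟨e, he, rfl⟩, p, hp, rfl⟩
  simp only [LinearMap.comp_apply, LinearMap.mulLeft_apply]
  rw [← mul_assoc, MvPolynomial.monomial_mul, mul_one]
  by_cases hsq : ∀ z, (multilinearExponent m + e) z ≤ 1
  · let M : K → Finset V := fun κ =>
      Finset.univ.filter (fun x => (multilinearExponent m + e) (κ, x) = 1)
    have hM : multilinearExponent m + e = multilinearExponent M := by
      ext ⟨κ, x⟩
      have := hsq (κ, x)
      simp only [multilinearExponent_apply, M, Finset.mem_filter, Finset.mem_univ, true_and]
      split_ifs <;> omega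
    have hsub : ∀ κ, m κ ⊆ M κ := by
      intro κ x hx
      have h2 := hsq (κ, x)
      simp only [M, Finset.mem_filter, Finset.mem_univ, true_and]
      rw [Finsupp.add_apply, multilinearExponent_apply, if_pos hx] at h2 ⊢
      omega
    have hcard : ∀ κ, l ≤ (M κ).card := fun κ => hm κ ▸ Finset.card_le_card (hsub κ)
    rw [hM]
    refine Submodule.subset_span ⟨(M, p), ?_, rfl⟩
    rw [Finset.mem_coe, Finset.mem_product]
    refine ⟨?_, hp⟩
    rw [nearLevel, Finset.mem_filter]
    refine ⟨Finset.mem_univ _, hcard, ?_⟩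
    have h3 : ∑ κ, ((M κ).card - l) + ∑ κ, (m κ).card = ∑ κ, (M κ).card := by
      rw [← Finset.sum_add_distrib]
      refine Finset.sum_congr rfl fun κ _ => ?_
      have := hcard κ
      rw [hm]
      omega
    have h4 : ∑ κ, (m κ).card + ∑ z, e z = ∑ κ, (M κ).card := by
      rw [← sum_multilinearExponent, ← sum_multilinearExponent, ← Finset.sum_add_distrib, ← hM]
      rfl
    have h5 : ∑ z, e z ≤ e.support.card := by
      rw [← Finset.sum_subset (Finset.subset_univ e.support) (fun z _ hz => by
        simpa using hz), Finset.card_eq_sum_ones]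
      refine Finset.sum_le_sum fun z _ => ?_
      have := hsq z
      rw [Finsupp.add_apply] at this
      omega
    change ∑ κ, ((M κ).card - l) ≤ t
    omega
  · push Not at hsq
    obtain ⟨z, hz⟩ := hsq
    convert Submodule.zero_mem _
    ext M
    rw [multilinearPart_apply, MvPolynomial.coeff_monomial_mul', if_neg]
    · rfl
    · intro h
      have h2 := h z
      rw [multilinearExponent_apply] at h2
      split_ifs at h2 <;> omega

/-- There are at most `(t + 1) ^ |K|` ways to distribute the excess over the sides, and an excess of
`e` on a side costs a factor `θ ^ e` with `θ = (N - l) / l`. -/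
theorem card_nearLevel_le {l t N : ℕ} (hN : Fintype.card V = N) (hl : 0 < l) (hlN : 2 * l ≤ N) :
    ((nearLevel K V l t).card : ℝ) ≤ (t + 1) ^ Fintype.card K *
      (N.choose l ^ Fintype.card K * (((N : ℝ) - l) / l) ^ t) := by
  classical
  have hl' : (0 : ℝ) < l := by exact_mod_cast hl
  have hlN' : 2 * (l : ℝ) ≤ N := by exact_mod_cast hlN
  set θ : ℝ := ((N : ℝ) - l) / l with hθ
  have hθ1 : 1 ≤ θ := by rw [hθ, le_div_iff₀ hl']; linarith
  let E : Finset (K → ℕ) :=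
    (Fintype.piFinset (fun _ : K => Finset.range (t + 1))).filter (fun e => ∑ κ, e κ ≤ t)
  have hsub : nearLevel K V l t ⊆ E.biUnion
      (fun e => Fintype.piFinset (fun κ => Finset.univ.powersetCard (l + e κ))) := by
    intro M hM
    obtain ⟨-, h1, h2⟩ := Finset.mem_filter.1 hM
    rw [Finset.mem_biUnion]
    refine ⟨fun κ => (M κ).card - l, ?_, ?_⟩
    · rw [Finset.mem_filter, Fintype.mem_piFinset]
      refine ⟨fun κ => ?_, h2⟩
      have : (M κ).card - l ≤ ∑ κ, ((M κ).card - l) :=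
        Finset.single_le_sum (f := fun κ => (M κ).card - l) (fun _ _ => Nat.zero_le _)
          (Finset.mem_univ κ)
      rw [Finset.mem_range]
      omega
    · rw [Fintype.mem_piFinset]
      intro κ
      have := h1 κ
      simp only [Finset.mem_powersetCard, Finset.subset_univ, true_and]
      omega
  have hterm : ∀ e ∈ E, ((Fintype.piFinset
      (fun κ => (Finset.univ : Finset V).powersetCard (l + e κ))).card : ℝ) ≤
      N.choose l ^ Fintype.card K * θ ^ t := by
    intro e he
    rw [Fintype.card_piFinset]
    simp only [Finset.card_powersetCard, Finset.card_univ, hN]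
    push_cast
    calc ∏ κ, (N.choose (l + e κ) : ℝ) ≤ ∏ κ, ((N.choose l : ℝ) * θ ^ e κ) :=
          Finset.prod_le_prod (fun _ _ => by positivity)
            (fun κ _ => choose_add_le N l (e κ) hl (by omega))
      _ = N.choose l ^ Fintype.card K * θ ^ ∑ κ, e κ := by
          rw [Finset.prod_mul_distrib, Finset.prod_const, Finset.card_univ,
            Finset.prod_pow_eq_pow_sum]
      _ ≤ _ := by
          gcongr
          exact (Finset.mem_filter.1 he).2
  calc ((nearLevel K V l t).card : ℝ) ≤ ((∑ e ∈ E, (Fintype.piFinset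
      (fun κ => (Finset.univ : Finset V).powersetCard (l + e κ))).card : ℕ) : ℝ) := by
        exact_mod_cast (Finset.card_le_card hsub).trans Finset.card_biUnion_le
    _ ≤ ∑ e ∈ E, (N.choose l ^ Fintype.card K * θ ^ t : ℝ) := by
        push_cast
        exact Finset.sum_le_sum hterm
    _ = E.card * (N.choose l ^ Fintype.card K * θ ^ t : ℝ) := by
        rw [Finset.sum_const, nsmul_eq_mul]
    _ ≤ _ := by
        have h1 : E.card ≤ (t + 1) ^ Fintype.card K := by
          refine (Finset.card_filter_le _ _).trans (le_of_eq ?_)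
          rw [Fintype.card_piFinset]
          simp
        have h2 : (E.card : ℝ) ≤ (t + 1) ^ Fintype.card K := by exact_mod_cast h1
        gcongr

end Projection

/-! ### The rank of the shifted coefficients of the graph polynomial -/

section GraphRank

set_option synthInstance.maxSize 2000

variable {A Q F : Type*} [Fintype A] [Fintype Q] [DecidableEq A] [DecidableEq Q] [Inhabited Q]
  [Field F] {k L₁ L₂ : ℕ}

theorem coeff_prod_sum_X_mul_C {B R : Type*} [Fintype B] [CommRing R]
    (w : Fin k → B → R) (f : Fin k → B) :
    MvPolynomial.coeff (∑ i, Finsupp.single (i, f i) 1)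
      (∏ i, ∑ p : B, MvPolynomial.X (i, p) * MvPolynomial.C (w i p)) = ∏ i, w i (f i) := by
  classical
  rw [Finset.prod_univ_sum]
  simp only [Fintype.piFinset_univ]
  have h1 : ∀ g : Fin k → B, ∏ i, (MvPolynomial.X (i, g i) * MvPolynomial.C (w i (g i)) :
      MvPolynomial (Fin k × B) R) =
      MvPolynomial.monomial (∑ i, Finsupp.single (i, g i) 1) (∏ i, w i (g i)) := by
    intro g
    have h2 : ∀ i, (MvPolynomial.X (i, g i) * MvPolynomial.C (w i (g i)) :
        MvPolynomial (Fin k × B) R) =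
        MvPolynomial.monomial (Finsupp.single (i, g i) 1) (w i (g i)) := by
      intro i
      rw [mul_comm, MvPolynomial.X, MvPolynomial.C_mul_monomial, mul_one]
    simp only [h2]
    rw [MvPolynomial.monomial_sum_index, map_prod, ← Finset.prod_mul_distrib]
    simp only [MvPolynomial.C_mul_monomial, mul_one]
  simp only [h1, MvPolynomial.coeff_sum, MvPolynomial.coeff_monomial]
  rw [Finset.sum_eq_single f]
  · rw [if_pos rfl]
  · intro g _ hgf
    rw [if_neg]
    intro h
    apply hgf
    funext i
    have h3 := DFunLike.congr_fun h (i, f i)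
    simp only [Finsupp.finsetSum_apply, Finsupp.single_apply, Prod.mk.injEq] at h3
    simpa [ite_and] using h3
  · simp

theorem prod_pathSum_eq_sum_monomial (a : Fin k × Bool → A) :
    ∏ s, pathSum (MvPolynomial.X : ZVar A Q k L₁ L₂ → MvPolynomial (ZVar A Q k L₁ L₂) F) s (a s) =
      ∑ u : Fin k × Bool → Fin L₁ → Q,
        MvPolynomial.monomial (multilinearExponent (fun s => trail L₂ (a s) (u s))) 1 := by
  classical
  simp only [pathSum]
  rw [Finset.prod_univ_sum]
  simp only [Fintype.piFinset_univ]
  refine Finset.sum_congr rfl fun u _ => ?_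
  rw [← prod_prod_X_eq_monomial]
  refine Finset.prod_congr rfl fun s _ => ?_
  rw [trail, Finset.prod_image, ← Finset.univ_product_univ, Finset.prod_product]
  rintro ⟨i, j⟩ - ⟨i', j'⟩ - h
  simp only [Prod.mk.injEq] at h
  simp [h.2.1, h.2.2.1]

/-- The shifted coefficient vector that belongs to a choice, on every side, of a label and of a set
of variables by which to shift. -/
noncomputable def shiftedVector (F : Type*) [Field F]
    (i : Fin k × Bool → A × Finset (Slot A Q L₁ L₂)) :
    (Fin k × Bool → Finset (Slot A Q L₁ L₂)) → F :=
  multilinearPart _ _ F (MvPolynomial.monomial (multilinearExponent (fun s => (i s).2)) 1 *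
    ∏ s, pathSum MvPolynomial.X s (i s).1)

theorem shiftedVector_apply (i : Fin k × Bool → A × Finset (Slot A Q L₁ L₂))
    (M : Fin k × Bool → Finset (Slot A Q L₁ L₂)) :
    shiftedVector F i M = ∑ u : Fin k × Bool → Fin L₁ → Q,
      if multilinearExponent (fun s => (i s).2) +
        multilinearExponent (fun s => trail L₂ (i s).1 (u s)) = multilinearExponent M
      then 1 else 0 := by
  rw [shiftedVector, prod_pathSum_eq_sum_monomial, Finset.mul_sum, multilinearPart_apply,
    MvPolynomial.coeff_sum]
  refine Finset.sum_congr rfl fun u _ => ?_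
  rw [MvPolynomial.monomial_mul, mul_one, MvPolynomial.coeff_monomial]

/-- The pairs of a label and a set of `l` variables avoiding some path with that label. -/
def avoidingPairs (A Q : Type*) [Fintype A] [Fintype Q] [DecidableEq A] [DecidableEq Q]
    [Inhabited Q] (L₁ L₂ l : ℕ) : Finset (A × Finset (Slot A Q L₁ L₂)) :=
  Finset.univ.filter (fun p : A × Finset (Slot A Q L₁ L₂) => p.2 ∈ avoidingSets L₁ L₂ l Q p.1)

/-- A family of paths avoided by the shift contributes a multilinear monomial that no other family
of paths with the same labels produces. -/
theorem shiftedVector_ne_zero (hL₂ : 0 < L₂) {l : ℕ}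
    {i : Fin k × Bool → A × Finset (Slot A Q L₁ L₂)} (hi : ∀ s, i s ∈ avoidingPairs A Q L₁ L₂ l) :
    shiftedVector F i ≠ 0 := by
  have h1 : ∀ s, ∃ u : Fin L₁ → Q, Disjoint (trail L₂ (i s).1 u) (i s).2 := fun s =>
    (Finset.mem_filter.1 (Finset.mem_filter.1 (hi s)).2).2
  choose u hu using h1
  intro h
  have h2 := congrFun h (fun s => (i s).2 ∪ trail L₂ (i s).1 (u s))
  have h3 : multilinearExponent (fun s => (i s).2) +
      multilinearExponent (fun s => trail L₂ (i s).1 (u s)) =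
      multilinearExponent (fun s => (i s).2 ∪ trail L₂ (i s).1 (u s)) := by
    ext ⟨s, x⟩
    simp only [Finsupp.add_apply, multilinearExponent_apply, Finset.mem_union]
    have h7 : x ∈ trail L₂ (i s).1 (u s) → x ∉ (i s).2 := fun hx =>
      Finset.disjoint_left.1 (hu s) hx
    by_cases h4 : x ∈ trail L₂ (i s).1 (u s)
    · simp [h4, h7 h4]
    · simp [h4]
  rw [shiftedVector_apply, ← h3, Finset.sum_eq_single u] at h2
  · simp at h2
  · intro u' _ hu'
    rw [if_neg]
    intro h5
    apply hu'
    funext s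
    exact trail_injective hL₂ (i s).1 (congrFun (multilinearExponent_injective
      (add_left_cancel h5)) s)
  · simp

/-- At a coordinate `M` where a shifted vector does not vanish, the shift is determined by `M` and a
family of paths contained in `M`; so the overlap at `M` is at most the number of such families. -/
theorem eq_sdiff_of_shiftedVector_ne_zero {i : Fin k × Bool → A × Finset (Slot A Q L₁ L₂)}
    {M : Fin k × Bool → Finset (Slot A Q L₁ L₂)} (h : shiftedVector F i M ≠ 0) :
    ∃ u : Fin k × Bool → Fin L₁ → Q, ∀ s, trail L₂ (i s).1 (u s) ⊆ M s ∧
      (i s).2 = M s \ trail L₂ (i s).1 (u s) := by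
  rw [shiftedVector_apply] at h
  obtain ⟨u, -, hu⟩ := Finset.exists_ne_zero_of_sum_ne_zero h
  have h1 := of_not_not (fun h2 => hu (if_neg h2))
  have h2 : ∀ s x, (if x ∈ (i s).2 then 1 else 0) +
      (if x ∈ trail L₂ (i s).1 (u s) then 1 else 0) = if x ∈ M s then 1 else 0 := fun s x =>
    DFunLike.congr_fun h1 (s, x)
  refine ⟨u, fun s => ⟨fun x hx => ?_, ?_⟩⟩
  · have h3 := h2 s x
    by_contra h4
    simp [hx, h4] at h3
  · ext x
    rw [Finset.mem_sdiff]
    have h3 := h2 s x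
    by_cases h4 : x ∈ (i s).2 <;> by_cases h5 : x ∈ trail L₂ (i s).1 (u s) <;>
      by_cases h6 : x ∈ M s <;> simp [h4, h5, h6] at h3 ⊢

/-- The rank bound applied to the shifted coefficient vectors.  Both the number of vectors and the
overlaps of their supports are products over the sides. -/
theorem card_avoidingPairs_pow_le [DecidableEq F] (hL₂ : 0 < L₂) (l : ℕ) :
    ((avoidingPairs A Q L₁ L₂ l).card ^ (2 * k)) ^ 2 ≤
      Module.finrank F (Submodule.span F (shiftedVector F ''
        ((Fintype.piFinset (fun _ : Fin k × Bool => avoidingPairs A Q L₁ L₂ l) : Finset _) :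
          Set (Fin k × Bool → A × Finset (Slot A Q L₁ L₂))))) *
      (∑ M ∈ Finset.univ.powersetCard (l + L₁ * L₂),
        (containedPaths (A := A) (Q := Q) (L₁ := L₁) (L₂ := L₂) M).card ^ 2) ^ (2 * k) := by
  have hK : Fintype.card (Fin k × Bool) = 2 * k := by simp [mul_comm]
  have h1 := card_sq_le_finrank_span_mul_sum
    (Fintype.piFinset (fun _ : Fin k × Bool => avoidingPairs A Q L₁ L₂ l)) (shiftedVector F)
    (fun i hi => shiftedVector_ne_zero hL₂ (Fintype.mem_piFinset.1 hi))
  rw [Fintype.card_piFinset, Finset.prod_const, Finset.card_univ, hK] at h1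
  refine h1.trans (Nat.mul_le_mul_left _ ?_)
  set I := Fintype.piFinset (fun _ : Fin k × Bool => avoidingPairs A Q L₁ L₂ l)
  set J := Fintype.piFinset (fun _ : Fin k × Bool =>
    (Finset.univ : Finset (Slot A Q L₁ L₂)).powersetCard (l + L₁ * L₂))
  have hfib : ∀ M, (I.filter (fun i => shiftedVector F i M ≠ 0)).card ≤
      ∏ s, (containedPaths (M s)).card := by
    intro M
    rw [← Fintype.card_piFinset (fun s => containedPaths (M s))]
    refine (Finset.card_le_card (t := (Fintype.piFinset (fun s => containedPaths (M s))).image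
      (fun c s => ((c s).1, M s \ trail L₂ (c s).1 (c s).2))) ?_).trans Finset.card_image_le
    intro i hi
    obtain ⟨u, hu⟩ := eq_sdiff_of_shiftedVector_ne_zero (Finset.mem_filter.1 hi).2
    rw [Finset.mem_image]
    refine ⟨fun s => ((i s).1, u s), ?_, ?_⟩
    · rw [Fintype.mem_piFinset]
      intro s
      exact Finset.mem_filter.2 ⟨Finset.mem_univ _, (hu s).1⟩
    · funext s
      simp only [← (hu s).2]
  have hzero : ∀ M, M ∉ J → (I.filter (fun i => shiftedVector F i M ≠ 0)).card = 0 := by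
    intro M hM
    rw [Finset.card_eq_zero]
    refine Finset.filter_eq_empty_iff.2 fun i hi h => hM ?_
    obtain ⟨u, hu⟩ := eq_sdiff_of_shiftedVector_ne_zero h
    rw [Fintype.mem_piFinset]
    intro s
    have h2 := Finset.mem_filter.1 (Fintype.mem_piFinset.1 hi s)
    have h3 := (Finset.mem_powersetCard.1 (Finset.mem_filter.1 h2.2).1).2
    have h4 := Finset.card_sdiff_add_card_eq_card (hu s).1
    rw [← (hu s).2, h3, card_trail] at h4
    rw [Finset.mem_powersetCard]
    exact ⟨Finset.subset_univ _, h4.symm⟩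
  calc ∑ M, (I.filter (fun i => shiftedVector F i M ≠ 0)).card ^ 2
      = ∑ M ∈ J, (I.filter (fun i => shiftedVector F i M ≠ 0)).card ^ 2 := by
        symm
        apply Finset.sum_subset (Finset.subset_univ _)
        intro M _ hM
        rw [hzero M hM, sq, mul_zero]
    _ ≤ ∑ M ∈ J, ∏ s, (containedPaths (M s)).card ^ 2 := by
        refine Finset.sum_le_sum fun M _ => ?_
        rw [Finset.prod_pow]
        exact Nat.pow_le_pow_left (hfib M) 2
    _ = _ := by
        rw [Finset.sum_prod_piFinset _ (fun _ M => (containedPaths M).card ^ 2),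
          Finset.prod_const, Finset.card_univ, hK]

end GraphRank

/-! ### The dimension inequality for a circuit -/

section Inequality

set_option synthInstance.maxSize 2000

variable {A Q U F : Type*} [Fintype A] [Fintype Q] [Fintype U] [DecidableEq A] [DecidableEq Q]
  [DecidableEq U] [Inhabited Q] [Inhabited U] [Field F] {k L₁ L₂ : ℕ}

/-- Every shifted vector comes from a coefficient of the graph polynomial, namely that of the
`y`-monomial which selects a pair of labels in every block. -/
theorem finrank_span_shiftedVector_le {l t : ℕ} (P : Finset (MvPolynomial (ZVar A Q k L₁ L₂) F))
    (hP : ∀ T : YVar A k →₀ ℕ, T.degree ≤ k → MvPolynomial.coeff T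
      (∏ i, ∑ p : A × A, MvPolynomial.X (i, p) * MvPolynomial.C
        (pathSum MvPolynomial.X (i, false) p.1 * pathSum MvPolynomial.X (i, true) p.2)) ∈
      smallSupport F (ZVar A Q k L₁ L₂) t *
        Submodule.span F (P : Set (MvPolynomial (ZVar A Q k L₁ L₂) F))) :
    Module.finrank F (Submodule.span F (shiftedVector F ''
      ((Fintype.piFinset (fun _ : Fin k × Bool => avoidingPairs A Q L₁ L₂ l) : Finset _) :
        Set (Fin k × Bool → A × Finset (Slot A Q L₁ L₂))))) ≤
      (nearLevel (Fin k × Bool) (Slot A Q L₁ L₂) l t).card * P.card := by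
  classical
  let f := fun q : (Fin k × Bool → Finset (Slot A Q L₁ L₂)) × MvPolynomial (ZVar A Q k L₁ L₂) F =>
        multilinearPart _ _ F (MvPolynomial.monomial (multilinearExponent q.1) 1 * q.2)
  have hle : Submodule.span F (shiftedVector F ''
      ((Fintype.piFinset (fun _ : Fin k × Bool => avoidingPairs A Q L₁ L₂ l) : Finset _) :
        Set (Fin k × Bool → A × Finset (Slot A Q L₁ L₂)))) ≤
      Submodule.span F (f '' (nearLevel (Fin k × Bool) (Slot A Q L₁ L₂) l t ×ˢ P : Finset _)) := by
    rw [Submodule.span_le]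
    rintro _ ⟨i, hi, rfl⟩
    have hi' := Fintype.mem_piFinset.1 (Finset.mem_coe.1 hi)
    refine multilinearPart_shift_mem_span _ (fun s => ?_) P ?_
    · have h2 := Finset.mem_filter.1 (hi' s)
      exact (Finset.mem_powersetCard.1 (Finset.mem_filter.1 h2.2).1).2
    · have h3 := hP (∑ j, Finsupp.single (j, ((i (j, false)).1, (i (j, true)).1)) 1)
        (by simp [map_sum])
      rw [coeff_prod_sum_X_mul_C (fun j (p : A × A) => pathSum MvPolynomial.X (j, false) p.1 *
        pathSum MvPolynomial.X (j, true) p.2)] at h3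
      rw [Fintype.prod_prod_type]
      simp only [Fintype.prod_bool]
      simpa only [mul_comm] using h3
  refine (Submodule.finrank_mono hle).trans ?_
  rw [← Finset.coe_image]
  refine (finrank_span_finset_le_card _).trans ?_
  exact Finset.card_image_le.trans (Finset.card_product _ _).le

variable [Inhabited A]

/-- The comparison of the two bounds for the dimension of the space of shifted coefficients of the
restricted iterated matrix product: a lower bound from the graph and an upper bound from the
circuit. -/
theorem card_avoidingPairs_pow_le_of_circuit {n d δ s : ℕ} (l : ℕ) (hL₂ : 0 < L₂)
    (hn : Fintype.card (Vert A Q U) ≤ n) (hd : k * (3 + 2 * (L₁ * (1 + 2 * L₂))) ≤ d)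
    {Φ : DepthFourCircuit F (Fin d × Fin n × Fin n)} (hΦ : Φ.SyntacticallyMultiIc δ)
    (heval : Φ.eval = iteratedMatMul F n d) (hs : Φ.numBottom < Fintype.card U ^ (s + 1)) :
    ((avoidingPairs A Q L₁ L₂ l).card ^ (2 * k)) ^ 2 ≤
      (nearLevel (Fin k × Bool) (Slot A Q L₁ L₂) l (s * k)).card *
        (Φ.numTop * (δ * Fintype.card (ZVar A Q k L₁ L₂) + 1) ^ k) *
      (∑ M ∈ Finset.univ.powersetCard (l + L₁ * L₂),
        (containedPaths (A := A) (Q := Q) (L₁ := L₁) (L₂ := L₂) M).card ^ 2) ^ (2 * k) := by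
  classical
  obtain ⟨pos, σ, hpos, hrest, hσ⟩ := exists_substitution (A := A) (Q := Q) (U := U) F hn hd
  obtain ⟨τ, hτ⟩ := exists_restriction pos Φ s hs
  obtain ⟨P, hP, hmem⟩ := exists_coeff_eval_mem pos τ (σ τ)
    (fun z u => by convert hpos τ z u) (hrest τ) hΦ (s := s)
    (fun b => by convert hτ b) k
  simp only [heval, hσ] at hmem
  refine (card_avoidingPairs_pow_le (F := F) hL₂ l).trans (Nat.mul_le_mul_right _ ?_)
  exact (finrank_span_shiftedVector_le P hmem).trans (Nat.mul_le_mul_left _ hP)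

end Inequality

/-- The common factor `(C ^ 2 * a) ^ (2 * k)` is cancelled from the comparison of two dimension
bounds. -/
theorem pow_le_of_le_mul_of_le {a C S W E T t b θ c G g : ℝ} {k s : ℕ} (ha : 0 < a) (hC : 0 < C)
    (hW : 0 ≤ W) (hT : 0 ≤ T) (ht : 0 ≤ t) (hE : 0 ≤ E) (hc : 0 ≤ c)
    (h₁ : a * C ≤ c * S) (h₂ : (S ^ (2 * k)) ^ 2 ≤ W * (T * t ^ k) * E ^ (2 * k))
    (h₃ : W ≤ b ^ (2 * k) * (C ^ (2 * k) * θ ^ (s * k))) (h₄ : E ≤ a * G ^ 2 * g * C) :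
    (a ^ 2) ^ k ≤ T * (b ^ 2 * θ ^ s * t * c ^ 4 * (G ^ 2 * g) ^ 2) ^ k := by
  have hB := hW.trans h₃
  have hkey : C ^ (4 * k) * a ^ (2 * k) * (a ^ 2) ^ k ≤ C ^ (4 * k) * a ^ (2 * k) *
      (T * (b ^ 2 * θ ^ s * t * c ^ 4 * (G ^ 2 * g) ^ 2) ^ k) := by
    calc C ^ (4 * k) * a ^ (2 * k) * (a ^ 2) ^ k = ((a * C) ^ (2 * k)) ^ 2 := by
          simp only [mul_pow, ← pow_mul]; ring
      _ ≤ ((c * S) ^ (2 * k)) ^ 2 := by gcongr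
      _ = c ^ (4 * k) * (S ^ (2 * k)) ^ 2 := by
          simp only [mul_pow, ← pow_mul]; ring
      _ ≤ c ^ (4 * k) * ((b ^ (2 * k) * (C ^ (2 * k) * θ ^ (s * k))) * (T * t ^ k) *
            (a * G ^ 2 * g * C) ^ (2 * k)) := by
          gcongr
          exact h₂.trans (by gcongr)
      _ = _ := by
          simp only [mul_pow, ← pow_mul]; ring
  exact le_of_mul_le_mul_left hkey (by positivity)

/-- The comparison of the two dimension bounds in terms of the parameters of the graph: `α` labels,
`w` states, `q` candidate positions for each variable, and `k` blocks, with shifts by sets of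
density `l / N`. -/
theorem card_pow_le_of_parameters {F : Type*} [Field F] {n d δ α w q L₁ L₂ k s l N : ℕ} {G : ℝ}
    (hN : N = α * (L₁ * (L₂ * (w * w)))) (hα : 0 < α) (hw : 0 < w) (hq : 0 < q) (hL₂ : 0 < L₂)
    (hl : 0 < l) (hlN : 2 * l ≤ N) (hn : α * (w * (w * q)) ≤ n)
    (hd : k * (3 + 2 * (L₁ * (1 + 2 * L₂))) ≤ d) (hLw : L₁ ^ 2 ≤ w)
    (hDN : 4 * (L₁ * L₂) ^ 2 ≤ N) (hrw : ((1 - (l : ℝ) / N)⁻¹) ^ L₂ ≤ w)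
    (hG : (w : ℝ) ^ L₁ * (((l : ℝ) + L₁ * L₂) / N) ^ (L₁ * L₂) *
      (((N : ℝ) - l) / l) ^ (L₁ * L₂) ≤ G)
    (hθα : (α : ℝ) ≤ (((N : ℝ) - l) / l) ^ (L₁ * L₂))
    {Φ : DepthFourCircuit F (Fin d × Fin n × Fin n)} (hΦ : Φ.SyntacticallyMultiIc δ)
    (heval : Φ.eval = iteratedMatMul F n d) (hs : Φ.numBottom < q ^ (s + 1)) :
    ((α : ℝ) ^ 2) ^ k ≤ Φ.numTop * (((s * k + 1 : ℕ) : ℝ) ^ 2 * (((N : ℝ) - l) / l) ^ s *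
      ((δ * (2 * k * N) + 1 : ℕ) : ℝ) * (4 * (2 * L₁ + 1)) ^ 4 *
        (G ^ 2 * (2 * L₁ + 2)) ^ 2) ^ k := by
  have : Inhabited (Fin α) := ⟨⟨0, hα⟩⟩
  have : Inhabited (Fin w) := ⟨⟨0, hw⟩⟩
  have : Inhabited (Fin q) := ⟨⟨0, hq⟩⟩
  have hN0 : 0 < N := by omega
  have hN0' : (0 : ℝ) < N := by exact_mod_cast hN0
  have hlN' : 2 * (l : ℝ) ≤ N := by exact_mod_cast hlN
  have hl' : (0 : ℝ) < l := by exact_mod_cast hl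
  have hα' : (0 : ℝ) < α := by exact_mod_cast hα
  have hcard : Fintype.card (Slot (Fin α) (Fin w) L₁ L₂) = N := by
    simp [hN]
  have hDle : L₁ * L₂ ≤ (L₁ * L₂) ^ 2 := Nat.le_self_pow two_ne_zero _
  set θ : ℝ := ((N : ℝ) - l) / l with hθ
  have hθ0 : 0 ≤ θ := div_nonneg (by linarith) hl'.le
  set C : ℝ := (N.choose l : ℝ) with hC
  have hC0 : 0 < C := by
    rw [hC]
    exact_mod_cast Nat.choose_pos (by omega)
  -- The number of shifted vectors per side.
  have hS : (α : ℝ) * C ≤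
      4 * (2 * L₁ + 1) * (avoidingPairs (Fin α) (Fin w) L₁ L₂ l).card := by
    have h1 : (avoidingPairs (Fin α) (Fin w) L₁ L₂ l).card =
        ∑ a : Fin α, (avoidingSets L₁ L₂ l (Fin w) a).card := by
      rw [avoidingPairs, Finset.card_filter, Fintype.sum_prod_type]
      refine Finset.sum_congr rfl fun a _ => ?_
      rw [← Finset.card_filter]
      congr 1
      ext m
      simp
    have h2 : ∀ a : Fin α, C ≤ 4 * (2 * L₁ + 1) * (avoidingSets L₁ L₂ l (Fin w) a).card :=
      fun a => choose_le_card_avoidingSets hcard hN0 (by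
        have : (l : ℝ) / N ≤ 1 / 2 := by rw [div_le_iff₀ hN0']; linarith
        linarith) (by simpa using hrw) (by simpa using hLw) hDN a
    rw [h1]
    push_cast
    rw [Finset.mul_sum]
    calc (α : ℝ) * C = ∑ _a : Fin α, C := by simp
      _ ≤ _ := Finset.sum_le_sum fun a _ => h2 a
  have hE := sum_card_containedPaths_sq_le (A := Fin α) (Q := Fin w) (G := G) hcard hl hlN
    (by simpa using hrw) (by simpa using hLw) (by omega) (by simpa using hG) (by simpa using hθα)
  have hnear := card_nearLevel_le (K := Fin k × Bool) (V := Slot (Fin α) (Fin w) L₁ L₂)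
    (l := l) (t := s * k) hcard hl hlN
  have hmain := card_avoidingPairs_pow_le_of_circuit (A := Fin α) (Q := Fin w) (U := Fin q) (k := k)
    l hL₂ (by simpa using hn) hd hΦ heval (by simpa using hs)
  have hK : Fintype.card (Fin k × Bool) = 2 * k := by simp [mul_comm]
  have hZ : Fintype.card (ZVar (Fin α) (Fin w) k L₁ L₂) = 2 * k * N := by
    rw [Fintype.card_prod, hK, hcard]
  rw [hK] at hnear
  rw [hZ] at hmain
  generalize (avoidingPairs (Fin α) (Fin w) L₁ L₂ l).card = S at *
  generalize (∑ M ∈ Finset.univ.powersetCard (l + L₁ * L₂),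
    (containedPaths (A := Fin α) (Q := Fin w) (L₁ := L₁) (L₂ := L₂) M).card ^ 2) = E at *
  generalize (nearLevel (Fin k × Bool) (Slot (Fin α) (Fin w) L₁ L₂) l (s * k)).card = W at *
  have hmain' : (((S : ℝ) ^ (2 * k)) ^ 2) ≤
      (W : ℝ) * (Φ.numTop * ((δ * (2 * k * N) + 1 : ℕ) : ℝ) ^ k) * (E : ℝ) ^ (2 * k) := by
    exact_mod_cast hmain
  simp only [Fintype.card_fin] at hE
  have hnear' : (W : ℝ) ≤ ((s * k + 1 : ℕ) : ℝ) ^ (2 * k) * (C ^ (2 * k) * θ ^ (s * k)) := by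
    push_cast
    simpa using hnear
  have hE' : (E : ℝ) ≤ α * G ^ 2 * (2 * L₁ + 2) * C := by simpa using hE
  exact pow_le_of_le_mul_of_le (by positivity) hC0 (by positivity) (by positivity)
    (by positivity) (by positivity) (by positivity) hS hmain' hnear' hE'

/-! ### The choice of the parameters -/

theorem exp_le_div_of_le_mul {N l h : ℝ} (hN : 0 < N) (hh' : h ≤ 1 / 100)
    (h₁ : l ≤ N * (1 / 2 - h)) (h₂ : N * (1 / 2 - 2 * h) ≤ l) :
    Real.exp (2 * h) ≤ (N - l) / l := by
  have hl : 0 < l := lt_of_lt_of_le (by nlinarith) h₂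
  rw [le_div_iff₀ hl]
  have h3 : Real.exp (2 * h) * (1 - 2 * h) ≤ 1 := by
    have := Real.one_sub_le_exp_neg (2 * h)
    calc Real.exp (2 * h) * (1 - 2 * h) ≤ Real.exp (2 * h) * Real.exp (-(2 * h)) := by gcongr
      _ = 1 := by rw [← Real.exp_add]; simp
  calc Real.exp (2 * h) * l ≤ Real.exp (2 * h) * (N * (1 / 2 - h)) := by gcongr
    _ = N / 2 * (Real.exp (2 * h) * (1 - 2 * h)) := by ring
    _ ≤ N / 2 * 1 := by gcongr
    _ ≤ N - l := by nlinarith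

theorem div_le_exp_of_mul_le {N l h : ℝ} (hN : 0 < N) (hh : 0 ≤ h) (hh' : h ≤ 1 / 100)
    (h₂ : N * (1 / 2 - 2 * h) ≤ l) :
    (N - l) / l ≤ Real.exp (12 * h) := by
  have hl : 0 < l := lt_of_lt_of_le (by nlinarith) h₂
  rw [div_le_iff₀ hl]
  have h3 := Real.add_one_le_exp (12 * h)
  have h4 : (1 + 4 * h) ≤ (12 * h + 1) * (1 - 4 * h) := by nlinarith
  calc N - l ≤ N / 2 * (1 + 4 * h) := by nlinarith
    _ ≤ N / 2 * ((12 * h + 1) * (1 - 4 * h)) := by gcongr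
    _ = (12 * h + 1) * (N * (1 / 2 - 2 * h)) := by ring
    _ ≤ Real.exp (12 * h) * l := by
        gcongr
        nlinarith

/-- When the number `w` of states is close to `(1 / 2 + h)⁻¹ ^ L₂`, the expected number of contained
paths of one label, scaled by `θ ^ (L₁ * L₂)` with `θ = (N - l) / l`, is bounded: each factor
`(l + L₁ * L₂) / N * θ` is close to `1 / 2 + h`. -/
theorem pow_mul_pow_mul_pow_le_exp {N l h w : ℝ} {L₁ L₂ : ℕ} (hN : 0 < N) (hh : 0 ≤ h)
    (hl : N * (1 / 2 - h) - 1 ≤ l) (hl' : l ≤ N) (hw0 : 0 ≤ w)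
    (hlN : N / 4 ≤ l)
    (hw : w ≤ ((1 / 2 + h)⁻¹) ^ L₂ + 1) (hL : (L₁ : ℝ) ≤ ((1 / 2 + h)⁻¹) ^ L₂)
    (hDN : 4 * ((L₁ * L₂ : ℕ) : ℝ) ^ 2 ≤ N) :
    w ^ L₁ * ((l + L₁ * L₂) / N) ^ (L₁ * L₂) * ((N - l) / l) ^ (L₁ * L₂) ≤ Real.exp 3 := by
  have hl0 : 0 < l := by linarith
  set B : ℝ := (1 / 2 + h)⁻¹ with hB
  have hB0 : 0 < B := by positivity
  set D : ℕ := L₁ * L₂ with hD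
  have hDD : (L₁ : ℝ) * L₂ = D := by simp [hD]
  have hD2 : (D : ℝ) ≤ (D : ℝ) ^ 2 := by exact_mod_cast Nat.le_self_pow two_ne_zero _
  have hBL : 0 < B ^ L₂ := by positivity
  have h1 : w ≤ B ^ L₂ * Real.exp ((B ^ L₂)⁻¹) := by
    calc w ≤ B ^ L₂ * ((B ^ L₂)⁻¹ + 1) := by
          rw [mul_add, mul_inv_cancel₀ hBL.ne']; linarith
      _ ≤ _ := by gcongr; exact Real.add_one_le_exp _
  have h2 : (l + L₁ * L₂) / N * ((N - l) / l) ≤ B⁻¹ * Real.exp (2 / N + D / l) := by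
    have e1 : (N - l) / N ≤ B⁻¹ * (2 / N + 1) := by
      rw [hB, inv_inv, div_le_iff₀ hN]
      have : (1 / 2 + h) * (2 / N + 1) * N = (1 / 2 + h) * (2 + N) := by field_simp
      rw [this]
      nlinarith
    calc (l + L₁ * L₂) / N * ((N - l) / l) = (N - l) / N * (D / l + 1) := by
          rw [hDD]; field_simp; ring
      _ ≤ B⁻¹ * (2 / N + 1) * (D / l + 1) := by gcongr
      _ ≤ B⁻¹ * Real.exp (2 / N) * Real.exp (D / l) := by
          gcongr <;> exact Real.add_one_le_exp _
      _ = _ := by rw [mul_assoc, ← Real.exp_add]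
  clear_value B
  have h0 : 0 ≤ (l + L₁ * L₂) / N * ((N - l) / l) :=
    mul_nonneg (by positivity) (div_nonneg (by linarith) hl0.le)
  calc w ^ L₁ * ((l + L₁ * L₂) / N) ^ D * ((N - l) / l) ^ D
      = w ^ L₁ * ((l + L₁ * L₂) / N * ((N - l) / l)) ^ D := by rw [mul_pow]; ring
    _ ≤ (B ^ L₂ * Real.exp ((B ^ L₂)⁻¹)) ^ L₁ * (B⁻¹ * Real.exp (2 / N + D / l)) ^ D := by
        gcongr
    _ = Real.exp (L₁ * (B ^ L₂)⁻¹ + D * (2 / N + D / l)) := by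
        rw [mul_pow, mul_pow, ← Real.exp_nat_mul, ← Real.exp_nat_mul, Real.exp_add, ← pow_mul,
          mul_comm L₂ L₁, ← hD, inv_pow]
        field_simp
    _ ≤ Real.exp 3 := by
        have a1 : (L₁ : ℝ) * (B ^ L₂)⁻¹ ≤ 1 := by
          rw [← div_eq_mul_inv]; exact div_le_one_of_le₀ hL hBL.le
        have a2 : (D : ℝ) * (2 / N) ≤ 1 := by
          rw [mul_div, div_le_one hN]; nlinarith
        have a3 : (D : ℝ) * (D / l) ≤ 1 := by
          rw [mul_div, div_le_one hl0]; nlinarith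
        gcongr
        linarith

theorem exp_half_le_inv {h : ℝ} (hh : 0 ≤ h) (hh' : h ≤ 1 / 100) :
    Real.exp (1 / 2) ≤ (1 / 2 + h)⁻¹ := by
  have h1 : (1.6 : ℝ) * 1.2 ≤ (1 / 2 + h)⁻¹ := by
    rw [le_inv_comm₀ (by norm_num) (by positivity)]
    norm_num
    linarith
  have h2 : Real.exp (1 / 2) ^ 2 ≤ 2.7182818286 := by
    rw [← Real.exp_nat_mul]
    have := Real.exp_one_lt_d9.le
    norm_num at this ⊢
    exact this
  nlinarith [Real.exp_pos (1 / 2)]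

/-- The critical number of states lies between two powers of `n = exp x`. -/
theorem inv_pow_bounds {x h : ℝ} {L₂ : ℕ} (hx : 1000 ≤ x) (hh0 : 0 ≤ h) (hh1 : h ≤ 1 / 100)
    (hL₂x : (L₂ : ℝ) ≤ x / 10) (hL₂x' : x / 10 - 1 ≤ L₂) :
    Real.exp (0.04 * x) ≤ ((1 / 2 + h)⁻¹) ^ L₂ ∧ ((1 / 2 + h)⁻¹) ^ L₂ ≤ Real.exp (0.07 * x) := by
  set B : ℝ := (1 / 2 + h)⁻¹ with hB
  have hB0 : 0 < B := by positivity
  have hB2 : B ≤ Real.exp 0.7 := by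
    have h1 : B ≤ 2 := by
      rw [hB, inv_le_comm₀ (by positivity) (by norm_num)]
      linarith
    have h2 : (2 : ℝ) ≤ Real.exp 0.7 := by
      rw [← Real.log_le_iff_le_exp (by norm_num)]
      linarith [Real.log_two_lt_d9]
    exact h1.trans h2
  have hBL : Real.exp (0.04 * x) ≤ B ^ L₂ := by
    calc Real.exp (0.04 * x) ≤ Real.exp (L₂ * (1 / 2)) := by
          refine Real.exp_le_exp.2 ?_
          linarith
      _ = Real.exp (1 / 2) ^ L₂ := Real.exp_nat_mul _ _
      _ ≤ B ^ L₂ := by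
          gcongr
          exact exp_half_le_inv hh0 hh1
  have hBL' : B ^ L₂ ≤ Real.exp (0.07 * x) := by
    calc B ^ L₂ ≤ Real.exp 0.7 ^ L₂ := by gcongr
      _ = Real.exp (L₂ * 0.7) := (Real.exp_nat_mul _ _).symm
      _ ≤ Real.exp (0.07 * x) := by
          refine Real.exp_le_exp.2 ?_
          linarith
  exact ⟨hBL, hBL'⟩

/-- The number `q` of candidate positions per variable and the number `α` of labels that fit into
`n` vertices: `α * w ^ 2 * q` is just below `n = exp x`. -/
theorem exists_label_count {n w : ℕ} {x : ℝ} (hx : 1000 ≤ x) (hn : (n : ℝ) = Real.exp x)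
    (hw0 : 0 < w) (hwx : (w : ℝ) ≤ Real.exp (0.071 * x)) :
    ∃ α q : ℕ, 0 < α ∧ 0 < q ∧ α * (w * (w * q)) ≤ n ∧ Real.exp (0.09 * x) ≤ q ∧
      Real.exp (0.75 * x) ≤ α ∧ (α : ℝ) ≤ Real.exp x := by
  obtain ⟨q, hq⟩ : ∃ q, q = ⌊Real.exp (0.1 * x)⌋₊ := ⟨_, rfl⟩
  have hqx : (q : ℝ) ≤ Real.exp (0.1 * x) := hq ▸ Nat.floor_le (Real.exp_pos _).le
  have hqx' : Real.exp (0.09 * x) ≤ q := by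
    have h0 := Nat.lt_floor_add_one (Real.exp (0.1 * x))
    rw [← hq] at h0
    have h1 : (0.1 : ℝ) * x = 0.09 * x + 0.01 * x := by ring
    have h2 := Real.add_one_le_exp (0.01 * x)
    have h3 : 1 ≤ Real.exp (0.09 * x) := Real.one_le_exp (by positivity)
    rw [h1, Real.exp_add] at h0
    nlinarith
  have hq0 : 0 < q := by
    have : (0 : ℝ) < q := lt_of_lt_of_le (by positivity) hqx'
    exact_mod_cast this
  have hwwq : ((w * (w * q) : ℕ) : ℝ) ≤ Real.exp (0.242 * x) := by
    push_cast
    calc (w : ℝ) * (w * q)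
        ≤ Real.exp (0.071 * x) * (Real.exp (0.071 * x) * Real.exp (0.1 * x)) := by gcongr
      _ = Real.exp (0.242 * x) := by
          rw [← Real.exp_add, ← Real.exp_add]
          ring_nf
  have hwwq0 : 0 < w * (w * q) := by positivity
  obtain ⟨α, hα⟩ : ∃ α, α = n / (w * (w * q)) := ⟨_, rfl⟩
  have hαn : α * (w * (w * q)) ≤ n := hα ▸ Nat.div_mul_le_self _ _
  have hαx : Real.exp (0.75 * x) ≤ α := by
    have h0 : n < (α + 1) * (w * (w * q)) := by
      rw [hα]
      exact Nat.lt_mul_of_div_lt (Nat.lt_succ_self _) hwwq0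
    have h1 : Real.exp x ≤ (α + 1) * Real.exp (0.242 * x) := by
      rw [← hn]
      calc (n : ℝ) ≤ (((α + 1) * (w * (w * q)) : ℕ) : ℝ) := by exact_mod_cast h0.le
        _ = (α + 1) * ((w * (w * q) : ℕ) : ℝ) := by push_cast; ring
        _ ≤ _ := by gcongr
    have h2 : Real.exp (0.758 * x) ≤ α + 1 := by
      refine le_of_mul_le_mul_right ?_ (Real.exp_pos (0.242 * x))
      rw [← Real.exp_add]
      refine le_trans (le_of_eq ?_) h1
      ring_nf
    have h3 : (0.758 : ℝ) * x = 0.75 * x + 0.008 * x := by ring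
    have h4 := Real.add_one_le_exp (0.008 * x)
    have h5 : 1 ≤ Real.exp (0.75 * x) := Real.one_le_exp (by positivity)
    rw [h3, Real.exp_add] at h2
    nlinarith
  have hα0 : 0 < α := by
    have : (0 : ℝ) < α := lt_of_lt_of_le (by positivity) hαx
    exact_mod_cast this
  have hαx' : (α : ℝ) ≤ Real.exp x := by
    rw [← hn]
    exact_mod_cast hα ▸ Nat.div_le_self _ _
  exact ⟨α, q, hα0, hq0, hαn, hqx', hαx, hαx'⟩

/-- The numbers `w` of states, `q` of candidate positions of a variable and `α` of labels, and the
size `l` of the shifts.  The density of the shifts is about `1 / 2 - h` with `h = 10 * x / R`.  For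
`θ = (N - l) / l` this makes `θ ^ (L₁ * L₂)` exceed the number of labels, while `θ ^ (R / 2000)`
stays a small power of `exp x`. -/
theorem exists_graph_parameters {n L₁ L₂ : ℕ} {x R : ℝ} (hx : 1000 ≤ x)
    (hxR : 2000 * x ≤ R) (hn : (n : ℝ) = Real.exp x) (hR : R ^ 2 ≤ Real.exp (0.01 * x))
    (hL₁0 : 0 < L₁) (hL₁R : (L₁ : ℝ) ≤ R / 1000) (hL₂x : (L₂ : ℝ) ≤ x / 10)
    (hL₂x' : x / 10 - 1 ≤ L₂)
    (hDR : (L₁ : ℝ) * L₂ ≤ R / 10) (hDR' : R / 20 ≤ (L₁ : ℝ) * L₂) :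
    ∃ α w q N l : ℕ, N = α * (L₁ * (L₂ * (w * w))) ∧ 0 < α ∧ 0 < w ∧ 0 < q ∧ 0 < l ∧ 2 * l ≤ N ∧
      α * (w * (w * q)) ≤ n ∧ L₁ ^ 2 ≤ w ∧ 4 * (L₁ * L₂) ^ 2 ≤ N ∧
      ((1 - (l : ℝ) / N)⁻¹) ^ L₂ ≤ w ∧
      (w : ℝ) ^ L₁ * (((l : ℝ) + L₁ * L₂) / N) ^ (L₁ * L₂) * (((N : ℝ) - l) / l) ^ (L₁ * L₂) ≤
        Real.exp 3 ∧
      (α : ℝ) ≤ (((N : ℝ) - l) / l) ^ (L₁ * L₂) ∧ ((N : ℝ) - l) / l ≤ Real.exp (120 * x / R) ∧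
      Real.exp (0.09 * x) ≤ q ∧ (N : ℝ) ≤ α * Real.exp (0.155 * x) ∧
      Real.exp (0.75 * x) ≤ α := by
  have hx0 : 0 < x := by linarith
  have hR0 : 0 < R := by linarith
  have hRR : R ≤ R ^ 2 := by nlinarith
  have hL₂0 : 0 < L₂ := by
    have : (0 : ℝ) < L₂ := by linarith
    exact_mod_cast this
  set h : ℝ := 10 * x / R with hh
  have hh0 : 0 < h := by positivity
  have hh1 : h ≤ 1 / 100 := by rw [hh, div_le_iff₀ hR0]; linarith
  have hhR : h * R = 10 * x := div_mul_cancel₀ _ hR0.ne'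
  set B : ℝ := (1 / 2 + h)⁻¹ with hB
  have hB0 : 0 < B := by positivity
  obtain ⟨hBL, hBL'⟩ : Real.exp (0.04 * x) ≤ B ^ L₂ ∧ B ^ L₂ ≤ Real.exp (0.07 * x) :=
    inv_pow_bounds hx hh0.le hh1 hL₂x hL₂x'
  have hL₁B : (L₁ : ℝ) ≤ B ^ L₂ := by
    calc (L₁ : ℝ) ≤ R ^ 2 := by linarith
      _ ≤ Real.exp (0.01 * x) := hR
      _ ≤ Real.exp (0.04 * x) := Real.exp_le_exp.2 (by linarith)
      _ ≤ _ := hBL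
  -- With `B ^ L₂` states, the expected number of avoided continuations of a step is about `1`.
  obtain ⟨w, hw⟩ : ∃ w, w = ⌈B ^ L₂⌉₊ := ⟨_, rfl⟩
  have hwB : B ^ L₂ ≤ w := hw ▸ Nat.le_ceil _
  have hwB' : (w : ℝ) ≤ B ^ L₂ + 1 := hw ▸ (Nat.ceil_lt_add_one (by positivity)).le
  have hwx : (w : ℝ) ≤ Real.exp (0.071 * x) := by
    have h1 : (0.071 : ℝ) * x = 0.07 * x + 0.001 * x := by ring
    have h2 := Real.add_one_le_exp (0.001 * x)
    have h3 : 1 ≤ Real.exp (0.07 * x) := Real.one_le_exp (by positivity)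
    rw [h1, Real.exp_add]
    nlinarith
  have hw0 : 0 < w := by
    have : (0 : ℝ) < w := lt_of_lt_of_le (by positivity) hwB
    exact_mod_cast this
  obtain ⟨α, q, hα0, hq0, hαn, hqx', hαx, hαx'⟩ := exists_label_count hx hn hw0 hwx
  obtain ⟨N, hN⟩ : ∃ N, N = α * (L₁ * (L₂ * (w * w))) := ⟨_, rfl⟩
  have hαN : α ≤ N := hN ▸ Nat.le_mul_of_pos_right _ (by positivity)
  have hNx : (N : ℝ) ≤ α * Real.exp (0.155 * x) := by
    calc (N : ℝ) = α * ((L₁ * L₂) * (w * w)) := by rw [hN]; push_cast; ring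
      _ ≤ α * (R ^ 2 * (w * w)) := by
          gcongr
          linarith
      _ ≤ α * (Real.exp (0.01 * x) * (w * w)) := by gcongr
      _ ≤ α * (Real.exp (0.01 * x) * (Real.exp (0.071 * x) * Real.exp (0.071 * x))) := by
          gcongr
      _ ≤ α * Real.exp (0.155 * x) := by
          rw [← Real.exp_add, ← Real.exp_add]
          gcongr
          linarith
  have hRN : R ^ 2 ≤ N := by
    calc R ^ 2 ≤ Real.exp (0.01 * x) := hR
      _ ≤ Real.exp (0.75 * x) := Real.exp_le_exp.2 (by linarith)
      _ ≤ α := hαx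
      _ ≤ N := by exact_mod_cast hαN
  have hN0 : (0 : ℝ) < N := by linarith
  have hNh : 1 ≤ N * h := by
    calc (1 : ℝ) ≤ h * R := by linarith
      _ ≤ N * h := by rw [mul_comm]; gcongr; linarith
  obtain ⟨l, hl⟩ : ∃ l, l = ⌊(N : ℝ) * (1 / 2 - h)⌋₊ := ⟨_, rfl⟩
  have hlN : (l : ℝ) ≤ N * (1 / 2 - h) :=
    hl ▸ Nat.floor_le (mul_nonneg hN0.le (by linarith))
  have hlN' : (N : ℝ) * (1 / 2 - h) - 1 ≤ l := by
    have := Nat.lt_floor_add_one ((N : ℝ) * (1 / 2 - h))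
    rw [← hl] at this
    linarith
  have hNh' : (N : ℝ) * h ≤ N * (1 / 100) := by gcongr
  have hNh0 : 0 ≤ (N : ℝ) * h := by positivity
  have hlN2 : (N : ℝ) * (1 / 2 - 2 * h) ≤ l := by linarith
  have hl4 : (N : ℝ) / 4 ≤ l := by linarith
  have hlNN : 2 * (l : ℝ) ≤ N := by linarith
  have hDN : 4 * ((L₁ * L₂ : ℕ) : ℝ) ^ 2 ≤ N := by
    push_cast
    calc 4 * ((L₁ : ℝ) * L₂) ^ 2 ≤ 4 * (R / 10) ^ 2 := by gcongr
      _ ≤ R ^ 2 := by linarith [sq_nonneg R]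
      _ ≤ N := hRN
  refine ⟨α, w, q, N, l, hN, hα0, hw0, hq0, ?_, ?_, hαn, ?_, by exact_mod_cast hDN, ?_, ?_, ?_, ?_,
    hqx', hNx, hαx⟩
  · have : (0 : ℝ) < l := by linarith
    exact_mod_cast this
  · exact_mod_cast hlNN
  · have : (L₁ : ℝ) ^ 2 ≤ w := by
      calc (L₁ : ℝ) ^ 2 ≤ R ^ 2 := by gcongr; linarith
        _ ≤ Real.exp (0.01 * x) := hR
        _ ≤ Real.exp (0.04 * x) := Real.exp_le_exp.2 (by linarith)
        _ ≤ w := hBL.trans hwB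
    exact_mod_cast this
  · have h1 : (l : ℝ) / N ≤ 1 / 2 - h := by rw [div_le_iff₀ hN0]; linarith
    have h2 : 1 / 2 + h ≤ 1 - (l : ℝ) / N := by linarith
    have h3 : 0 < 1 - (l : ℝ) / N := by linarith
    refine le_trans ?_ hwB
    rw [hB]
    gcongr
  · exact pow_mul_pow_mul_pow_le_exp hN0 hh0.le hlN' (by linarith) (Nat.cast_nonneg _) hl4 hwB'
      hL₁B hDN
  · calc (α : ℝ) ≤ Real.exp x := hαx'
      _ ≤ Real.exp ((L₁ * L₂ : ℕ) * (2 * h)) := by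
          gcongr
          push_cast
          calc x = R / 20 * (2 * h) := by linarith
            _ ≤ L₁ * L₂ * (2 * h) := by gcongr
      _ = Real.exp (2 * h) ^ (L₁ * L₂) := Real.exp_nat_mul _ _
      _ ≤ _ := by
          gcongr
          exact exp_le_div_of_le_mul hN0 hh1 hlN hlN2
  · refine (div_le_exp_of_mul_le hN0 hh0.le hh1 hlN2).trans (le_of_eq ?_)
    rw [hh]
    ring_nf

/-- The number `T` of top gates is large: all factors on the right of the inequality `hmain`
together are at most `α * exp (0.35 * x)` in each of the `k` blocks, against `α ^ 2` on the left. -/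
theorem le_numTop_of_pow_le {k s δ N L₁ α T : ℕ} {x R θ : ℝ} (hx : 1000 ≤ x)
    (hxR : 2000 * x ≤ R) (hR : R ^ 2 ≤ Real.exp (0.01 * x)) (hkR : (k : ℝ) ≤ R)
    (hkR' : R / 2 ≤ k) (hsR : (s : ℝ) ≤ R / 2000) (hL₁R : (L₁ : ℝ) ≤ R / 1000)
    (hδ : (δ : ℝ) ≤ Real.exp (0.016 * x)) (hθ0 : 0 ≤ θ) (hθ : θ ≤ Real.exp (120 * x / R))
    (hNx : (N : ℝ) ≤ α * Real.exp (0.155 * x)) (hαx : Real.exp (0.75 * x) ≤ α)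
    (hmain : ((α : ℝ) ^ 2) ^ k ≤ T * (((s * k + 1 : ℕ) : ℝ) ^ 2 * θ ^ s *
      ((δ * (2 * k * N) + 1 : ℕ) : ℝ) * (4 * (2 * L₁ + 1)) ^ 4 *
        (Real.exp 3 ^ 2 * (2 * L₁ + 2)) ^ 2) ^ k) :
    Real.exp (x * R / 50000) ≤ T := by
  have hx0 : 0 < x := by linarith
  have hR0 : 0 < R := by linarith
  have hα0 : (0 : ℝ) < α := lt_of_lt_of_le (Real.exp_pos _) hαx
  have hα1 : (1 : ℝ) ≤ α := le_trans (Real.one_le_exp (by positivity)) hαx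
  have hRx : R ≤ Real.exp (0.01 * x) := by nlinarith
  have h1 : ((s * k + 1 : ℕ) : ℝ) ^ 2 ≤ Real.exp (0.02 * x) := by
    have : ((s * k + 1 : ℕ) : ℝ) ≤ R ^ 2 := by
      push_cast
      calc (s : ℝ) * k + 1 ≤ R / 2000 * R + 1 := by gcongr
        _ ≤ R ^ 2 := by nlinarith
    calc ((s * k + 1 : ℕ) : ℝ) ^ 2 ≤ Real.exp (0.01 * x) ^ 2 := by
          gcongr
          exact this.trans hR
      _ = Real.exp (0.02 * x) := by
          rw [← Real.exp_nat_mul]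
          ring_nf
  have h2 : θ ^ s ≤ Real.exp (0.06 * x) := by
    calc θ ^ s ≤ Real.exp (120 * x / R) ^ s := by gcongr
      _ = Real.exp (s * (120 * x / R)) := (Real.exp_nat_mul _ _).symm
      _ ≤ Real.exp (R / 2000 * (120 * x / R)) := by gcongr
      _ = Real.exp (0.06 * x) := by
          congr 1
          field_simp
          norm_num
  have h3 : ((δ * (2 * k * N) + 1 : ℕ) : ℝ) ≤ α * Real.exp (0.19 * x) := by
    push_cast
    have e1 : (δ : ℝ) * (2 * k * N) ≤ 2 * (α * Real.exp (0.181 * x)) := by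
      calc (δ : ℝ) * (2 * k * N) ≤ Real.exp (0.016 * x) *
            (2 * Real.exp (0.01 * x) * (α * Real.exp (0.155 * x))) := by
            gcongr
            exact hkR.trans hRx
        _ = 2 * (α * (Real.exp (0.016 * x) * Real.exp (0.01 * x) * Real.exp (0.155 * x))) := by
            ring
        _ = _ := by
            rw [← Real.exp_add, ← Real.exp_add]
            ring_nf
    have e2 : 1 ≤ α * Real.exp (0.181 * x) :=
      one_le_mul_of_one_le_of_one_le hα1 (Real.one_le_exp (by positivity))
    have e3 : 3 ≤ Real.exp (0.009 * x) := by linarith [Real.add_one_le_exp (0.009 * x)]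
    calc (δ : ℝ) * (2 * k * N) + 1 ≤ 3 * (α * Real.exp (0.181 * x)) := by linarith
      _ ≤ Real.exp (0.009 * x) * (α * Real.exp (0.181 * x)) := by gcongr
      _ = α * (Real.exp (0.009 * x) * Real.exp (0.181 * x)) := by ring
      _ = _ := by
          rw [← Real.exp_add]
          ring_nf
  have h4 : (4 * (2 * (L₁ : ℝ) + 1)) ^ 4 ≤ Real.exp (0.02 * x) := by
    calc (4 * (2 * (L₁ : ℝ) + 1)) ^ 4 ≤ R ^ 4 := by
          gcongr
          linarith
      _ = (R ^ 2) ^ 2 := by ring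
      _ ≤ Real.exp (0.01 * x) ^ 2 := by gcongr
      _ = Real.exp (0.02 * x) := by
          rw [← Real.exp_nat_mul]
          ring_nf
  have h5 : (Real.exp 3 ^ 2 * (2 * (L₁ : ℝ) + 2)) ^ 2 ≤ Real.exp (0.04 * x) := by
    calc (Real.exp 3 ^ 2 * (2 * (L₁ : ℝ) + 2)) ^ 2 ≤
          (Real.exp (0.01 * x) * Real.exp (0.01 * x)) ^ 2 := by
          gcongr
          · rw [← Real.exp_nat_mul]
            refine Real.exp_le_exp.2 ?_
            push_cast
            linarith
          · linarith
      _ = Real.exp (0.04 * x) := by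
          rw [← Real.exp_add, ← Real.exp_nat_mul]
          ring_nf
  have hprod : ((s * k + 1 : ℕ) : ℝ) ^ 2 * θ ^ s * ((δ * (2 * k * N) + 1 : ℕ) : ℝ) *
      (4 * (2 * L₁ + 1)) ^ 4 * (Real.exp 3 ^ 2 * (2 * L₁ + 2)) ^ 2 ≤ α * Real.exp (0.35 * x) := by
    calc _ ≤ Real.exp (0.02 * x) * Real.exp (0.06 * x) * (α * Real.exp (0.19 * x)) *
          Real.exp (0.02 * x) * Real.exp (0.04 * x) := by gcongr
      _ = α * (Real.exp (0.02 * x) * Real.exp (0.06 * x) * Real.exp (0.19 * x) *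
          Real.exp (0.02 * x) * Real.exp (0.04 * x)) := by ring
      _ ≤ α * Real.exp (0.35 * x) := by
          rw [← Real.exp_add, ← Real.exp_add, ← Real.exp_add, ← Real.exp_add]
          gcongr
          linarith
  have hpow : (α : ℝ) ^ k * (Real.exp (0.35 * x) * Real.exp (0.4 * x)) ^ k ≤
      (α : ℝ) ^ k * (T * Real.exp (0.35 * x) ^ k) := by
    calc (α : ℝ) ^ k * (Real.exp (0.35 * x) * Real.exp (0.4 * x)) ^ k
        = (α : ℝ) ^ k * Real.exp (0.75 * x) ^ k := by
          rw [← Real.exp_add]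
          ring_nf
      _ ≤ (α : ℝ) ^ k * (α : ℝ) ^ k := by gcongr
      _ = ((α : ℝ) ^ 2) ^ k := by rw [← mul_pow, ← sq]
      _ ≤ T * (α * Real.exp (0.35 * x)) ^ k := by
          refine hmain.trans ?_
          gcongr
      _ = _ := by rw [mul_pow]; ring
  have hT : Real.exp (0.4 * x) ^ k ≤ T := by
    have := le_of_mul_le_mul_left hpow (by positivity)
    rw [mul_pow, mul_comm] at this
    exact le_of_mul_le_mul_right this (by positivity)
  refine le_trans ?_ hT
  rw [← Real.exp_nat_mul]
  refine Real.exp_le_exp.2 ?_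
  calc x * R / 50000 ≤ R / 2 * (0.4 * x) := by linarith [mul_pos hx0 hR0]
    _ ≤ k * (0.4 * x) := by gcongr

/-- The parameters in terms of `x = log n` and `R = √d`.  The circuit either has `exp (0.09 * x)` to
the power `R / 2000` many bottom gates, or else the inequality `card_pow_le_of_parameters` applies
and bounds the number of its top gates. -/
theorem exp_le_size {F : Type*} [Field F] {n d δ : ℕ} {x R : ℝ} (hx : 1000 ≤ x)
    (hxR : 2000 * x ≤ R) (hn : (n : ℝ) = Real.exp x) (hd : (d : ℝ) = R ^ 2)
    (hR : R ^ 2 ≤ Real.exp (0.01 * x)) (hδ : (δ : ℝ) ≤ Real.exp (0.016 * x))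
    {Φ : DepthFourCircuit F (Fin d × Fin n × Fin n)} (hΦ : Φ.SyntacticallyMultiIc δ)
    (heval : Φ.eval = iteratedMatMul F n d) :
    Real.exp (x * R / 50000) ≤ Φ.size := by
  have hx0 : 0 < x := by linarith
  have hR0 : 0 < R := by linarith
  have hR1 : 1 ≤ R := by linarith
  -- The number of blocks and the shape of a block.
  obtain ⟨k, hk⟩ : ∃ k, k = ⌊R⌋₊ := ⟨_, rfl⟩
  obtain ⟨L₁, hL₁⟩ : ∃ k, k = ⌊R / x⌋₊ := ⟨_, rfl⟩
  obtain ⟨L₂, hL₂⟩ : ∃ k, k = ⌊x / 10⌋₊ := ⟨_, rfl⟩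
  obtain ⟨s, hs⟩ : ∃ k, k = ⌊R / 2000⌋₊ := ⟨_, rfl⟩
  have hkR : (k : ℝ) ≤ R := hk ▸ Nat.floor_le hR0.le
  have hkR' : R / 2 ≤ k := by
    have := Nat.lt_floor_add_one R
    rw [← hk] at this
    linarith
  have hLx : 2000 ≤ R / x := by rwa [le_div_iff₀ hx0]
  have hL₁x : (L₁ : ℝ) ≤ R / x := hL₁ ▸ Nat.floor_le (by positivity)
  have hL₁x' : R / x * 0.99 ≤ L₁ := by
    have := Nat.lt_floor_add_one (R / x)
    rw [← hL₁] at this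
    linarith
  have hL₂x : (L₂ : ℝ) ≤ x / 10 := hL₂ ▸ Nat.floor_le (by positivity)
  have hL₂x' : x / 10 - 1 ≤ L₂ := by
    have := Nat.lt_floor_add_one (x / 10)
    rw [← hL₂] at this
    linarith
  have hsR : (s : ℝ) ≤ R / 2000 := hs ▸ Nat.floor_le (by positivity)
  have hsR' : R / 2000 ≤ s + 1 := by
    have := Nat.lt_floor_add_one (R / 2000)
    rw [← hs] at this
    linarith
  have hL₁R : (L₁ : ℝ) ≤ R / 1000 := by
    refine hL₁x.trans ?_
    gcongr
  have hDR : (L₁ : ℝ) * L₂ ≤ R / 10 := by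
    calc (L₁ : ℝ) * L₂ ≤ R / x * (x / 10) := by gcongr
      _ = R / 10 := by field_simp
  have hDR' : R / 20 ≤ (L₁ : ℝ) * L₂ := by
    calc R / 20 = R / x * 0.99 * (x / 19.8) := by field_simp; norm_num
      _ ≤ (L₁ : ℝ) * L₂ := by
        gcongr
        have : x / 19.8 = x / 10 - x * (9.8 / 198) := by ring
        linarith
  have hL₁0 : 0 < L₁ := by
    have : (0 : ℝ) < L₁ := by linarith
    exact_mod_cast this
  have hL₂0 : 0 < L₂ := by
    have : (0 : ℝ) < L₂ := by linarith
    exact_mod_cast this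
  obtain ⟨α, w, q, N, l, hN, hα0, hw0, hq0, hl0, hlN, hαn, hLw, hDN, hrw, hG, hθα, hθ, hqx, hNx,
    hαx⟩ := exists_graph_parameters hx hxR hn hR hL₁0 hL₁R hL₂x hL₂x' hDR hDR'
  by_cases hb : Φ.numBottom < q ^ (s + 1)
  · have hkd : k * (3 + 2 * (L₁ * (1 + 2 * L₂))) ≤ d := by
      have h1 : (1 : ℝ) ≤ L₂ := by exact_mod_cast hL₂0
      have h2 : (L₁ : ℝ) ≤ L₁ * L₂ := by nlinarith [(Nat.cast_nonneg L₁ : (0 : ℝ) ≤ L₁)]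
      have : (k : ℝ) * (3 + 2 * (L₁ * (1 + 2 * L₂))) ≤ d := by
        rw [hd, sq]
        gcongr
        linarith
      exact_mod_cast this
    have hmain := card_pow_le_of_parameters hN hα0 hw0 hq0 hL₂0 hl0 hlN hαn hkd hLw hDN hrw hG hθα
      hΦ heval hb
    refine (le_numTop_of_pow_le hx hxR hR hkR hkR' hsR hL₁R hδ ?_ hθ hNx hαx hmain).trans ?_
    · exact div_nonneg (by
        have : 2 * (l : ℝ) ≤ N := by exact_mod_cast hlN
        linarith [(Nat.cast_nonneg l : (0 : ℝ) ≤ l)]) (Nat.cast_nonneg _)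
    · have : Φ.numTop ≤ Φ.size := by unfold DepthFourCircuit.size; omega
      exact_mod_cast this
  · have h1 : ((q ^ (s + 1) : ℕ) : ℝ) ≤ Φ.size := by
      have : q ^ (s + 1) ≤ Φ.size := by unfold DepthFourCircuit.size; omega
      exact_mod_cast this
    refine le_trans ?_ h1
    push_cast
    calc Real.exp (x * R / 50000) ≤ Real.exp ((s + 1 : ℕ) * (0.09 * x)) := by
          refine Real.exp_le_exp.2 ?_
          push_cast
          calc x * R / 50000 ≤ R / 2000 * (0.09 * x) := by linarith [mul_pos hx0 hR0]
            _ ≤ (s + 1) * (0.09 * x) := by gcongr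
      _ = Real.exp (0.09 * x) ^ (s + 1) := Real.exp_nat_mul _ _
      _ ≤ (q : ℝ) ^ (s + 1) := by gcongr

theorem mainTheorem1 :
    ∃ c : ℝ, 0 < c ∧
      ∀ f : ℕ → ℝ, Tendsto (fun n : ℕ => f n / (Real.log n) ^ 2) atTop atTop →
        ∃ n₀ : ℕ, ∀ n d δ : ℕ, n₀ ≤ n →
          f n ≤ (d : ℝ) → (d : ℝ) ≤ (n : ℝ) ^ (0.01 : ℝ) → (δ : ℝ) ≤ (n : ℝ) ^ (0.016 : ℝ) →
            ∀ (F : Type*) [Field F] (Φ : DepthFourCircuit F (Fin d × Fin n × Fin n)),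
              Φ.SyntacticallyMultiIc δ → Φ.eval = iteratedMatMul F n d →
                (n : ℝ) ^ (c * Real.sqrt d) ≤ (Φ.size : ℝ) := by
  refine ⟨1 / 50000, by norm_num, fun f hf => ?_⟩
  have hlog : ∀ᶠ n : ℕ in atTop, 1000 ≤ Real.log n :=
    (Real.tendsto_log_atTop.comp tendsto_natCast_atTop_atTop).eventually_ge_atTop 1000
  -- The bound `2000 ^ 2` makes `√d` at least `2000 * log n`.
  obtain ⟨n₀, hn₀⟩ := eventually_atTop.1
    (hlog.and ((hf.eventually_ge_atTop (2000 ^ 2)).and (eventually_gt_atTop 0)))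
  refine ⟨n₀, fun n d δ hn hfd hd hδ F _ Φ hΦ heval => ?_⟩
  obtain ⟨hx, hfn, hn0⟩ := hn₀ n hn
  have hn0' : (0 : ℝ) < n := by exact_mod_cast hn0
  have hx2 : 0 < Real.log n ^ 2 := by positivity
  have hrpow : ∀ y : ℝ, (n : ℝ) ^ y = Real.exp (y * Real.log n) := fun y => by
    rw [Real.rpow_def_of_pos hn0', mul_comm]
  have hxR : 2000 * Real.log n ≤ Real.sqrt d := by
    refine Real.le_sqrt_of_sq_le ?_
    rw [le_div_iff₀ hx2] at hfn
    rw [mul_pow]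
    exact hfn.trans hfd
  have hsq : (d : ℝ) = Real.sqrt d ^ 2 := (Real.sq_sqrt (Nat.cast_nonneg d)).symm
  rw [hrpow] at hd hδ ⊢
  refine le_trans (le_of_eq ?_) (exp_le_size hx hxR (Real.exp_log hn0').symm hsq (hsq ▸ hd) hδ
    hΦ heval)
  congr 1
  ring
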